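/- Let $H$ be a complex Hilbert space. For a compact operator $A$ on $H$ let $\mu_1(A)\ge\mu_2(A)\ge\dots$ be the eigenvalues of $|A|$ in non-increasing order, counted with multiplicity (completed by zeros if $A$ has finite rank). A *tracial weight* on $B(H)$ is an additive and positively homogeneous map $\tau$ from the positive bounded operators to $[0,\infty]$ with $\tau(A^*A)=\tau(AA^*)$ for all $A\in B(H)$; it is a *singular trace* if it vanishes on all finite rank projections. A compact operator $A$ is *singularly traceable* if there is a singular trace $\tau$ with $0<\tau(|A|)<\infty$. For a compact operator $A$ of infinite rank put $\mu_A(x)=\mu_n(A)$ for $x\in[n,n+1)$, $n\ge 1$, put $f_A(t)=-\log\mu_A(e^t)$ for $t\ge 0$, and $$\underline c(A)=\Big(\lim_{h\to\infty}\limsup_{t\to\infty}\frac{f_A(t+h)-f_A(t)}{h}\Big)^{-1},\qquad \overline c(A)=\Big(\lim_{h\to\infty}\liminf_{t\to\infty}\frac{f_A(t+h)-f_A(t)}{h}\Big)^{-1}$$ in $[0,\infty]$, with $1/0=\infty$ and $1/\infty=0$. **Theorem 3.1.** Let $0<\beta\le\alpha$ and let $(a_n)_{n\ge 0}$ be a non-decreasing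 sequence of real numbers with $a_0=0$ and $a_1>0$. Set $b_n=\sum_{k=0}^n a_k$, let $\varphi(t)=\alpha$ for $t\in[b_n,b_{n+1})$ with $n$ even and $\varphi(t)=\beta$ for $t\in[b_n,b_{n+1})$ with $n$ odd, and let $f(t)=\int_0^t\varphi(s)\,ds$ for $t\ge 0$. Let $T$ be a compact operator on $H$ with $\mu_n(T)=e^{-f(\log n)}$ for all $n\ge 1$. Then the two limits over $h$ that define $\underline c(T)$ and $\overline c(T)$ exist, and for every real $\gamma>0$ the operator $|T|^\gamma$ (which is $T^\gamma$ if $T\ge 0$) is singularly traceable if and only if $\gamma\in[\underline c(T),\overline c(T)]$. -/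

import Mathlib

open Filter Topology MeasureTheory
open scoped ENNReal NNReal

noncomputable section

section Operators

variable {H : Type*} [NormedAddCommGroup H] [InnerProductSpace ℂ H] [CompleteSpace H]

/-- The span of all eigenvectors of the operator `B` that belong to real eigenvalues `≥ r`. -/
def spectralSubspaceGE (B : H →L[ℂ] H) (r : ℝ) : Submodule ℂ H :=
  ⨆ s ∈ Set.Ici r, Module.End.eigenspace (B : H →ₗ[ℂ] H) (s : ℂ)

/-- The `n`-th singular value `μ_n(A)`, `n = 1, 2, …`, of a compact operator `A`: the `n`-th term of
the sequence of the eigenvalues of `|A|`, in non-increasing order and counted with multiplicity.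
It is the largest `r > 0` such that at least `n` eigenvalues of `|A|`, with multiplicity, are `≥ r`,
and it is `0` if there is no such `r`. (For compact `A` and `r > 0` the dimension is finite.) -/
def singularValue (A : H →L[ℂ] H) (n : ℕ) : ℝ :=
  sSup {r : ℝ | 0 < r ∧ n ≤ Module.finrank ℂ (spectralSubspaceGE (CFC.abs A) r)}

/-- The locally constant function `μ_A(x) = μ_n(A)` for `x ∈ [n, n + 1)`. -/
def singularValueFun (A : H →L[ℂ] H) (x : ℝ) : ℝ :=
  singularValue A ⌊x⌋₊

/-- The function `f_A(t) = - log μ_A(e ^ t)`, for an operator `A` of infinite rank and `t ≥ 0`. -/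
def logSingularValueFun (A : H →L[ℂ] H) (t : ℝ) : ℝ :=
  -Real.log (singularValueFun A (Real.exp t))

/-- The difference quotient `(f_A(t + h) - f_A(t)) / h`, which is nonnegative for `t ≥ 0`, `h > 0`
because `f_A` is non-decreasing. -/
def logSlope (A : H →L[ℂ] H) (h t : ℝ) : ℝ≥0∞ :=
  ENNReal.ofReal ((logSingularValueFun A (t + h) - logSingularValueFun A t) / h)

/-- The upper limit of `(f_A(t + h) - f_A(t)) / h` as `t → ∞`. -/
def upperSlope (A : H →L[ℂ] H) (h : ℝ) : ℝ≥0∞ :=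
  limsup (fun t : ℝ => logSlope A h t) atTop

/-- The lower limit of `(f_A(t + h) - f_A(t)) / h` as `t → ∞`. -/
def lowerSlope (A : H →L[ℂ] H) (h : ℝ) : ℝ≥0∞ :=
  liminf (fun t : ℝ => logSlope A h t) atTop

/-- The number `c̲(A)`, the inverse of the limit of `upperSlope A h` as `h → ∞`
(with `1 / 0 = ∞` and `1 / ∞ = 0`). -/
def lowerC (A : H →L[ℂ] H) : ℝ≥0∞ :=
  (limUnder atTop (upperSlope A))⁻¹

/-- The number `c̄(A)`, the inverse of the limit of `lowerSlope A h` as `h → ∞`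
(with `1 / 0 = ∞` and `1 / ∞ = 0`). -/
def upperC (A : H →L[ℂ] H) : ℝ≥0∞ :=
  (limUnder atTop (lowerSlope A))⁻¹

/-- The power `|T| ^ γ`, `γ > 0`, by continuous functional calculus; it is `T ^ γ` if `T ≥ 0`. -/
def absPow (T : H →L[ℂ] H) (γ : ℝ) : H →L[ℂ] H :=
  CFC.abs T ^ γ

variable (H) in
/-- A tracial weight on `B(H)`: an additive, positively homogeneous map from the positive bounded
operators to `[0, ∞]` with `τ(A* A) = τ(A A*)` for every bounded operator `A`. (The values of the
underlying function at operators that are not positive are irrelevant.) -/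
structure TracialWeight where
  toFun : (H →L[ℂ] H) → ℝ≥0∞
  map_add : ∀ A B : H →L[ℂ] H, A.IsPositive → B.IsPositive → toFun (A + B) = toFun A + toFun B
  map_smul : ∀ (c : ℝ≥0) (A : H →L[ℂ] H), A.IsPositive →
    toFun (((c : ℝ) : ℂ) • A) = (c : ℝ≥0∞) * toFun A
  map_star_mul_self : ∀ A : H →L[ℂ] H, toFun (star A * A) = toFun (A * star A)

/-- A singular trace is a tracial weight that vanishes on the finite rank projections. -/
def TracialWeight.IsSingular (τ : TracialWeight H) : Prop :=
  ∀ P : H →L[ℂ] H, IsStarProjection P → FiniteDimensional ℂ (P : H →ₗ[ℂ] H).range → τ.toFun P = 0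

/-- A compact operator `A` is singularly traceable if some singular trace is finite and non-zero
on `|A|`. -/
def SingularlyTraceable (A : H →L[ℂ] H) : Prop :=
  IsCompactOperator A ∧
    ∃ τ : TracialWeight H, τ.IsSingular ∧ τ.toFun (CFC.abs A) ≠ 0 ∧ τ.toFun (CFC.abs A) ≠ ∞

end Operators

/-- The points `b_n = a_0 + a_1 + … + a_n`. -/
def breakPoint (a : ℕ → ℝ) (n : ℕ) : ℝ :=
  ∑ k ∈ Finset.range (n + 1), a k

open Classical in
/-- The function `φ` that is `α` on `[b_n, b_{n+1})` for `n` even and `β` on `[b_n, b_{n+1})` for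
`n` odd (for `t ≥ 0`, if these intervals cover `[0, ∞)`). -/
def slopeFun (α β : ℝ) (a : ℕ → ℝ) (t : ℝ) : ℝ :=
  if ∃ n : ℕ, Even n ∧ t ∈ Set.Ico (breakPoint a n) (breakPoint a (n + 1)) then α else β

/-- The function `f(t) = ∫_0^t φ(s) ds`. -/
def profileFun (α β : ℝ) (a : ℕ → ℝ) (t : ℝ) : ℝ :=
  ∫ s in (0 : ℝ)..t, slopeFun α β a s

end

/-! Put D = |T|^γ. Its positive eigenvalues are simple: l i = exp(-γ f(log(i + 1))) for i = 0, 1, ….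
Let A and B be the largest and smallest mean slopes of f over long intervals far out, so that c̲ =
1/A and c̄ = 1/B. The claim becomes: D is singularly traceable iff 1 ≤ γA and γB ≤ 1.

Necessity. If γA < 1, there are k and c with ck > 1 and c · l i ≤ l (k i + j) for all j < k. Then c
times the sum of k copies of D, transported to the residue classes modulo k of the eigenbasis, lies
below D. Tracial weights are invariant under this transport, so ck τ(D) ≤ τ(D) and τ(D) is 0 or ∞
(`TracialWeight.eq_zero_or_top_of_slow_decay`). If γB > 1, the reverse comparison holds with ck < 1
up to finite rank, which a singular trace ignores (`TracialWeight.eq_zero_or_top_of_fast_decay`).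

Sufficiency. Let σ_n be the Ky Fan sums and w j the eigenvalue of D with 1-based index 2^j. The
trace is an ultralimit of the increments of σ from 2^p to 2^q, divided by the sum of 2^j w j over p
≤ j < q. For positive X, Y one has σ_n(X + Y) ≤ σ_n(X) + σ_n(Y) ≤ σ_{2n}(X + Y), so additivity fails
by at most one dyadic block at an end of the window; it holds in the limit if the end terms are
negligible against the sum (`windowTrace_add`).

Such windows exist: 2^j w j = exp(t - γ f(t)) at t = j log 2. If a is unbounded, then A = α, B = β,
and t - γ f(t) does not decrease before, and does not increase after, a change of slope from β to α;
long windows around these points serve. If a is bounded, f stays at bounded distance from the line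
of slope (α + β)/2, so A = B, γ = 1/A, the terms are bounded above and below, and every long window
serves. -/

/-! ### Ky Fan sums as suprema of traces of compressions. -/

section KyFan

open scoped InnerProductSpace

variable {H : Type*} [NormedAddCommGroup H] [InnerProductSpace ℂ H]

/-- The real part of the trace of the compression of `B` to the finite-dimensional subspace `E`. -/
noncomputable def traceOn (E : Submodule ℂ H) [FiniteDimensional ℂ E] (B : H →L[ℂ] H) : ℝ :=
  ∑ i, (⟪(stdOrthonormalBasis ℂ E i : H), B (stdOrthonormalBasis ℂ E i)⟫_ℂ).re

/-- The trace of an endomorphism does not depend on a basis; hence `traceOn` may be computed in any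
orthonormal basis of `E`. -/
theorem trace_compression_eq_sum {ι : Type*} [Fintype ι] (E : Submodule ℂ H)
    [FiniteDimensional ℂ E] (B : H →L[ℂ] H) (b : OrthonormalBasis ι ℂ E) :
    LinearMap.trace ℂ E ((E.orthogonalProjectionOnto.comp (B.comp E.subtypeL)) : E →ₗ[ℂ] E)
      = ∑ i, ⟪(b i : H), B (b i)⟫_ℂ := by
  rw [LinearMap.trace_eq_sum_inner _ b]
  refine Finset.sum_congr rfl fun i _ => ?_
  simp only [Submodule.coe_inner]
  change ⟪(b i : H), E.starProjection (B (b i))⟫_ℂ = _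
  rw [← Submodule.inner_starProjection_left_eq_right,
    Submodule.starProjection_eq_self_iff.mpr (b i).2]

theorem traceOn_eq_sum {ι : Type*} [Fintype ι] (E : Submodule ℂ H) [FiniteDimensional ℂ E]
    (B : H →L[ℂ] H) (b : OrthonormalBasis ι ℂ E) :
    traceOn E B = ∑ i, (⟪(b i : H), B (b i)⟫_ℂ).re := by
  rw [traceOn, ← Complex.re_sum, ← Complex.re_sum,
    ← trace_compression_eq_sum E B b, ← trace_compression_eq_sum E B (stdOrthonormalBasis ℂ E)]

theorem traceOn_eq_sum_of_span {ι : Type*} [Fintype ι] (E : Submodule ℂ H) [FiniteDimensional ℂ E]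
    (B : H →L[ℂ] H) {v : ι → H} (hv : Orthonormal ℂ v)
    (hE : Submodule.span ℂ (Set.range v) = E) :
    traceOn E B = ∑ i, (⟪v i, B (v i)⟫_ℂ).re := by
  have hmem : ∀ i, v i ∈ E := fun i => hE ▸ Submodule.subset_span ⟨i, rfl⟩
  let w : ι → E := fun i => ⟨v i, hmem i⟩
  have hw : Orthonormal ℂ w := by
    rw [← E.subtypeₗᵢ.orthonormal_comp_iff]
    exact hv
  have hspan : ⊤ ≤ Submodule.span ℂ (Set.range w) := by
    rintro ⟨x, hx⟩ -
    have h1 : Submodule.map E.subtype (Submodule.span ℂ (Set.range w)) = E := by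
      rw [Submodule.map_span, ← Set.range_comp]
      exact hE
    have h2 : x ∈ Submodule.map E.subtype (Submodule.span ℂ (Set.range w)) := by rwa [h1]
    obtain ⟨y, hy, rfl⟩ := h2
    exact hy
  rw [traceOn_eq_sum E B (OrthonormalBasis.mk hw hspan)]
  simp [w]

theorem traceOn_add (E : Submodule ℂ H) [FiniteDimensional ℂ E] (B C : H →L[ℂ] H) :
    traceOn E (B + C) = traceOn E B + traceOn E C := by
  simp [traceOn, Finset.sum_add_distrib]

theorem traceOn_smul (E : Submodule ℂ H) [FiniteDimensional ℂ E] (c : ℝ) (B : H →L[ℂ] H) :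
    traceOn E ((c : ℂ) • B) = c * traceOn E B := by
  simp [traceOn, Finset.mul_sum]

theorem stdOrthonormalBasis_coe_orthonormal (E : Submodule ℂ H) [FiniteDimensional ℂ E] :
    Orthonormal ℂ fun i => (stdOrthonormalBasis ℂ E i : H) :=
  (stdOrthonormalBasis ℂ E).orthonormal.comp_linearIsometry E.subtypeₗᵢ

theorem span_stdOrthonormalBasis_coe (E : Submodule ℂ H) [FiniteDimensional ℂ E] :
    Submodule.span ℂ (Set.range fun i => (stdOrthonormalBasis ℂ E i : H)) = E := by
  have : (Set.range fun i => (stdOrthonormalBasis ℂ E i : H))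
      = E.subtype '' Set.range (stdOrthonormalBasis ℂ E) := by
    rw [← Set.range_comp]; rfl
  have h2 : Submodule.span ℂ (Set.range (stdOrthonormalBasis ℂ E)) = ⊤ := by
    simpa using (stdOrthonormalBasis ℂ E).toBasis.span_eq
  rw [this, ← Submodule.map_span, h2, Submodule.map_top, Submodule.range_subtype]

theorem traceOn_sup (E F : Submodule ℂ H) [FiniteDimensional ℂ E] [FiniteDimensional ℂ F]
    (h : E ⟂ F) (B : H →L[ℂ] H) : traceOn (E ⊔ F) B = traceOn E B + traceOn F B := by
  have hE := stdOrthonormalBasis_coe_orthonormal E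
  have hF := stdOrthonormalBasis_coe_orthonormal F
  rw [traceOn_eq_sum_of_span (E ⊔ F) B
    (v := Sum.elim (fun i => (stdOrthonormalBasis ℂ E i : H))
      (fun i => (stdOrthonormalBasis ℂ F i : H))), Fintype.sum_sum_type]
  · rfl
  · refine ⟨?_, ?_⟩
    · rintro (i | i)
      · exact hE.1 i
      · exact hF.1 i
    · rintro (i | i) (j | j) hij
      · exact hE.2 (fun h => hij (by rw [h]))
      · exact h.inner_eq (SetLike.coe_mem _) (SetLike.coe_mem _)
      · exact h.symm.inner_eq (SetLike.coe_mem _) (SetLike.coe_mem _)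
      · exact hF.2 (fun h => hij (by rw [h]))
  · rw [Set.Sum.elim_range, Submodule.span_union, span_stdOrthonormalBasis_coe,
      span_stdOrthonormalBasis_coe]

theorem traceOn_le {E : Submodule ℂ H} [FiniteDimensional ℂ E] {B : H →L[ℂ] H} {c : ℝ}
    (h : ∀ x ∈ E, (⟪x, B x⟫_ℂ).re ≤ c * ‖x‖ ^ 2) : traceOn E B ≤ Module.finrank ℂ E * c := by
  calc traceOn E B ≤ ∑ _i : Fin (Module.finrank ℂ E), c := by
        refine Finset.sum_le_sum fun i _ => ?_
        have := h _ (stdOrthonormalBasis ℂ E i).2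
        rwa [(stdOrthonormalBasis_coe_orthonormal E).1 i, one_pow, mul_one] at this
    _ = _ := by simp

theorem le_traceOn {E : Submodule ℂ H} [FiniteDimensional ℂ E] {B : H →L[ℂ] H} {c : ℝ}
    (h : ∀ x ∈ E, c * ‖x‖ ^ 2 ≤ (⟪x, B x⟫_ℂ).re) : Module.finrank ℂ E * c ≤ traceOn E B := by
  calc (Module.finrank ℂ E * c : ℝ) = ∑ _i : Fin (Module.finrank ℂ E), c := by simp
    _ ≤ traceOn E B := by
        refine Finset.sum_le_sum fun i _ => ?_
        have := h _ (stdOrthonormalBasis ℂ E i).2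
        rwa [(stdOrthonormalBasis_coe_orthonormal E).1 i, one_pow, mul_one] at this

theorem re_inner_nonneg_of_isPositive {B : H →L[ℂ] H} (hB : B.IsPositive) (x : H) :
    0 ≤ (⟪x, B x⟫_ℂ).re := hB.re_inner_nonneg_right x

theorem re_inner_le_opNorm (B : H →L[ℂ] H) (x : H) : (⟪x, B x⟫_ℂ).re ≤ ‖B‖ * ‖x‖ ^ 2 := by
  calc (⟪x, B x⟫_ℂ).re ≤ ‖⟪x, B x⟫_ℂ‖ := Complex.re_le_norm _
    _ ≤ ‖x‖ * ‖B x‖ := norm_inner_le_norm _ _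
    _ ≤ ‖x‖ * (‖B‖ * ‖x‖) := by gcongr; exact B.le_opNorm x
    _ = _ := by ring

theorem traceOn_nonneg (E : Submodule ℂ H) [FiniteDimensional ℂ E] {B : H →L[ℂ] H}
    (hB : B.IsPositive) : 0 ≤ traceOn E B :=
  Finset.sum_nonneg fun _ _ => re_inner_nonneg_of_isPositive hB _

theorem traceOn_eq_add_inf_orthogonal {E F : Submodule ℂ H} [FiniteDimensional ℂ E]
    [FiniteDimensional ℂ F] (h : E ≤ F) (B : H →L[ℂ] H) :
    traceOn F B = traceOn E B + traceOn (Eᗮ ⊓ F) B := by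
  rw [← traceOn_sup]
  · congr 1
    exact (Submodule.sup_orthogonal_inf_of_hasOrthogonalProjection h).symm
  · rw [Submodule.isOrtho_iff_le]
    intro x hx
    rw [Submodule.mem_orthogonal]
    intro y hy
    exact Submodule.inner_left_of_mem_orthogonal hx hy.1

theorem traceOn_mono {E F : Submodule ℂ H} [FiniteDimensional ℂ E]
    [FiniteDimensional ℂ F] (h : E ≤ F) {B : H →L[ℂ] H} (hB : B.IsPositive) :
    traceOn E B ≤ traceOn F B := by
  rw [traceOn_eq_add_inf_orthogonal h B]
  linarith [traceOn_nonneg (Eᗮ ⊓ F) hB]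

/-- The supremum of the traces of the compressions of `B` to subspaces of dimension at most `n`,
which is the sum of the `n` largest eigenvalues if `B` is a positive compact operator. -/
noncomputable def kyFan (B : H →L[ℂ] H) (n : ℕ) : ℝ :=
  sSup {r : ℝ | ∃ (E : Submodule ℂ H) (_ : FiniteDimensional ℂ E),
    Module.finrank ℂ E ≤ n ∧ r = traceOn E B}

theorem traceOn_le_kyFan {B : H →L[ℂ] H} {n : ℕ} (E : Submodule ℂ H)
    [hE : FiniteDimensional ℂ E] (h : Module.finrank ℂ E ≤ n) : traceOn E B ≤ kyFan B n := by
  refine le_csSup ⟨n * ‖B‖, ?_⟩ ⟨E, hE, h, rfl⟩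
  rintro r ⟨F, hF, hn, rfl⟩
  refine (traceOn_le fun x _ => re_inner_le_opNorm B x).trans ?_
  gcongr

theorem kyFan_le {B : H →L[ℂ] H} {n : ℕ} {c : ℝ}
    (h : ∀ (E : Submodule ℂ H) [FiniteDimensional ℂ E], Module.finrank ℂ E ≤ n →
      traceOn E B ≤ c) : kyFan B n ≤ c := by
  refine csSup_le ⟨traceOn ⊥ B, ⊥, inferInstance, by simp, rfl⟩ ?_
  rintro r ⟨F, hF, hn, rfl⟩
  exact h F hn

theorem kyFan_mono (B : H →L[ℂ] H) {m n : ℕ} (h : m ≤ n) : kyFan B m ≤ kyFan B n :=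
  kyFan_le fun E _ hE => traceOn_le_kyFan E (hE.trans h)

theorem kyFan_add_le (B C : H →L[ℂ] H) (n : ℕ) : kyFan (B + C) n ≤ kyFan B n + kyFan C n :=
  kyFan_le fun E _ hE => by
    rw [traceOn_add]
    exact add_le_add (traceOn_le_kyFan E hE) (traceOn_le_kyFan E hE)

/-- Test spaces `E` for `B` and `F` for `C` both lie in `E ⊔ F`, of dimension at most 2n, and
positivity lets the traces only grow. -/
theorem kyFan_add_kyFan_le {B C : H →L[ℂ] H} (hB : B.IsPositive) (hC : C.IsPositive) (n : ℕ) :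
    kyFan B n + kyFan C n ≤ kyFan (B + C) (2 * n) := by
  rw [← le_sub_iff_add_le]
  refine kyFan_le fun E _ hE => ?_
  rw [le_sub_iff_add_le, ← le_sub_iff_add_le']
  refine kyFan_le fun F _ hF => ?_
  rw [le_sub_iff_add_le']
  calc traceOn E B + traceOn F C ≤ traceOn (E ⊔ F) B + traceOn (E ⊔ F) C :=
        add_le_add (traceOn_mono le_sup_left hB) (traceOn_mono le_sup_right hC)
    _ = traceOn (E ⊔ F) (B + C) := (traceOn_add _ _ _).symm
    _ ≤ _ := traceOn_le_kyFan _ (by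
        have := Submodule.finrank_add_le_finrank_add_finrank E F
        omega)

theorem kyFan_smul {c : ℝ} (hc : 0 < c) (B : H →L[ℂ] H) (n : ℕ) :
    kyFan ((c : ℂ) • B) n = c * kyFan B n := by
  apply le_antisymm
  · refine kyFan_le fun E _ hE => ?_
    rw [traceOn_smul]
    gcongr
    exact traceOn_le_kyFan E hE
  · rw [← le_div_iff₀' hc]
    refine kyFan_le fun E _ hE => ?_
    rw [le_div_iff₀' hc, ← traceOn_smul]
    exact traceOn_le_kyFan E hE

theorem kyFan_zero (n : ℕ) : kyFan (0 : H →L[ℂ] H) n = 0 := by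
  apply le_antisymm
  · exact kyFan_le fun E _ _ => by simp [traceOn]
  · have : traceOn ⊥ (0 : H →L[ℂ] H) ≤ kyFan 0 n := traceOn_le_kyFan ⊥ (by simp)
    simpa [traceOn] using this

theorem exists_le_finrank_eq (E : Submodule ℂ H) [FiniteDimensional ℂ E] {m : ℕ}
    (h : m ≤ Module.finrank ℂ E) : ∃ V : Submodule ℂ H, V ≤ E ∧ Module.finrank ℂ V = m := by
  let v : Fin m → H := fun i => (stdOrthonormalBasis ℂ E (Fin.castLE h i) : H)
  have hv : LinearIndependent ℂ v :=
    (stdOrthonormalBasis_coe_orthonormal E).linearIndependent.comp _ (Fin.castLE_injective h)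
  refine ⟨Submodule.span ℂ (Set.range v), ?_, by simpa using finrank_span_eq_card hv⟩
  rw [Submodule.span_le]
  rintro _ ⟨i, rfl⟩
  exact SetLike.coe_mem _

/-- Rank-nullity for the orthogonal projection from `V` to `E`, whose kernel lies in `Eᗮ`. -/
theorem finrank_le_add_finrank_inf_orthogonal (V E : Submodule ℂ H) [FiniteDimensional ℂ V]
    [FiniteDimensional ℂ E] :
    Module.finrank ℂ V ≤ Module.finrank ℂ E + Module.finrank ℂ (V ⊓ Eᗮ : Submodule ℂ H) := by
  let p : V →ₗ[ℂ] E := (E.orthogonalProjectionOnto : H →ₗ[ℂ] E) ∘ₗ V.subtype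
  have h1 := p.finrank_range_add_finrank_ker
  have h2 : Module.finrank ℂ p.range ≤ Module.finrank ℂ E := Submodule.finrank_le _
  have h3 : Module.finrank ℂ p.ker ≤ Module.finrank ℂ (V ⊓ Eᗮ : Submodule ℂ H) := by
    have : p.ker.map V.subtype ≤ V ⊓ Eᗮ := by
      rintro _ ⟨x, hx, rfl⟩
      refine ⟨x.2, ?_⟩
      have : E.orthogonalProjectionOnto (x : H) = 0 := hx
      simpa using this
    calc Module.finrank ℂ p.ker = Module.finrank ℂ (p.ker.map V.subtype) :=
          (p.ker.equivMapOfInjective _ V.injective_subtype).finrank_eq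
      _ ≤ _ := Submodule.finrank_mono this
  omega

/-- One half of the min-max principle: in a test space `E`, the part `E ⊓ Fᗮ` contributes at most
`c` per dimension, and its complement in `E` has dimension at most dim F ≤ n. -/
theorem kyFan_le_add {B : H →L[ℂ] H} {F : Submodule ℂ H} [FiniteDimensional ℂ F] {n : ℕ} {c : ℝ}
    (hc : 0 ≤ c) (hF : Module.finrank ℂ F ≤ n) (h : ∀ x ∈ Fᗮ, (⟪x, B x⟫_ℂ).re ≤ c * ‖x‖ ^ 2)
    (m : ℕ) : kyFan B m ≤ kyFan B n + m * c := by
  refine kyFan_le fun E _ hE => ?_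
  have hle : E ⊓ Fᗮ ≤ E := inf_le_left
  rw [traceOn_eq_add_inf_orthogonal hle B, add_comm]
  have h1 := finrank_le_add_finrank_inf_orthogonal E F
  have h2 : Module.finrank ℂ (E ⊓ Fᗮ : Submodule ℂ H)
      + Module.finrank ℂ ((E ⊓ Fᗮ)ᗮ ⊓ E : Submodule ℂ H) = Module.finrank ℂ E :=
    Submodule.finrank_add_inf_finrank_orthogonal hle
  have h3 : Module.finrank ℂ (E ⊓ Fᗮ : Submodule ℂ H) ≤ m := by omega
  refine add_le_add (traceOn_le_kyFan _ (by omega)) ?_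
  refine (traceOn_le (c := c) fun x hx => h x (Submodule.mem_inf.mp hx).2).trans ?_
  gcongr

/-- The other half: a test space of dimension at most `n` leaves `m` dimensions of `V` orthogonal to
it, and adding them gains at least `c` each. -/
theorem kyFan_add_le_kyFan {B : H →L[ℂ] H} {V : Submodule ℂ H}
    [FiniteDimensional ℂ V] {n m : ℕ} {c : ℝ} (hV : n + m ≤ Module.finrank ℂ V)
    (h : ∀ x ∈ V, c * ‖x‖ ^ 2 ≤ (⟪x, B x⟫_ℂ).re) : kyFan B n + m * c ≤ kyFan B (n + m) := by
  rw [← le_sub_iff_add_le]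
  refine kyFan_le fun E _ hE => ?_
  rw [le_sub_iff_add_le]
  have h1 := finrank_le_add_finrank_inf_orthogonal V E
  obtain ⟨W, hW, hWm⟩ := exists_le_finrank_eq (V ⊓ Eᗮ) (m := m) (by omega)
  have : FiniteDimensional ℂ W := Submodule.finiteDimensional_of_le hW
  have horth : E ⟂ W := by
    rw [Submodule.isOrtho_comm, Submodule.isOrtho_iff_le]
    exact hW.trans inf_le_right
  have h2 := le_traceOn (E := W) (B := B) (c := c) fun x hx => h x (hW hx).1
  rw [hWm] at h2
  calc traceOn E B + m * c ≤ traceOn E B + traceOn W B := by gcongr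
    _ = traceOn (E ⊔ W) B := (traceOn_sup E W horth B).symm
    _ ≤ _ := traceOn_le_kyFan _ (by
        have := Submodule.finrank_add_le_finrank_add_finrank E W
        omega)

variable [CompleteSpace H]

/-- With F = A(E), Parseval in `F` turns the trace of A*A on `E` into a double sum of |⟪b i, A* g
l⟫|²; summing over i first, Bessel bounds it by the trace of AA* on `F`. -/
theorem kyFan_star_mul_self_le (A : H →L[ℂ] H) (n : ℕ) :
    kyFan (star A * A) n ≤ kyFan (A * star A) n := by
  refine kyFan_le fun E _ hE => ?_
  let F : Submodule ℂ H := E.map (A : H →ₗ[ℂ] H)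
  have hF : Module.finrank ℂ F ≤ n := (Submodule.finrank_map_le _ _).trans hE
  refine le_trans ?_ (traceOn_le_kyFan F hF)
  let b := stdOrthonormalBasis ℂ E
  let g := stdOrthonormalBasis ℂ F
  have hb : ∀ i, (⟪(b i : H), (star A * A) (b i)⟫_ℂ).re
      = ∑ l, ‖⟪(b i : H), star A (g l)⟫_ℂ‖ ^ 2 := by
    intro i
    let y : F := ⟨A (b i), Submodule.mem_map_of_mem (b i).2⟩
    have h1 : (⟪(b i : H), (star A * A) (b i)⟫_ℂ).re = ‖y‖ ^ 2 := by
      rw [mul_apply_eq_comp, ContinuousLinearMap.star_eq_adjoint,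
        ContinuousLinearMap.adjoint_inner_right]
      exact inner_self_eq_norm_sq (𝕜 := ℂ) (A (b i : H))
    rw [h1, ← g.sum_sq_norm_inner_left]
    refine Finset.sum_congr rfl fun l _ => ?_
    rw [ContinuousLinearMap.star_eq_adjoint, ContinuousLinearMap.adjoint_inner_right]
    rfl
  have hg : ∀ l, (⟪(g l : H), (A * star A) (g l)⟫_ℂ).re = ‖star A (g l)‖ ^ 2 := by
    intro l
    rw [mul_apply_eq_comp, ← ContinuousLinearMap.adjoint_inner_left,
      ← ContinuousLinearMap.star_eq_adjoint]
    exact inner_self_eq_norm_sq (𝕜 := ℂ) (star A (g l : H))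
  calc traceOn E (star A * A) = ∑ i, ∑ l, ‖⟪(b i : H), star A (g l)⟫_ℂ‖ ^ 2 :=
        Finset.sum_congr rfl fun i _ => hb i
    _ = ∑ l, ∑ i, ‖⟪(b i : H), star A (g l)⟫_ℂ‖ ^ 2 := Finset.sum_comm
    _ ≤ ∑ l, ‖star A (g l)‖ ^ 2 := by
        refine Finset.sum_le_sum fun l _ => ?_
        exact (stdOrthonormalBasis_coe_orthonormal E).sum_inner_products_le _
    _ = traceOn F (A * star A) := Finset.sum_congr rfl fun l _ => (hg l).symm

theorem kyFan_star_mul_self (A : H →L[ℂ] H) (n : ℕ) :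
    kyFan (star A * A) n = kyFan (A * star A) n := by
  refine le_antisymm (kyFan_star_mul_self_le A n) ?_
  simpa using kyFan_star_mul_self_le (star A) n

end KyFan

/-! ### Singular traces as ultralimits over dyadic windows. -/

section WindowTrace

open scoped InnerProductSpace

variable {H : Type*} [NormedAddCommGroup H] [InnerProductSpace ℂ H]

/-- The quadratic form of `B` is bounded by `C * w j` off a subspace of dimension at most `2 ^ j`,
for all `j`: the eigenvalues of `B` are dominated by the sequence `w` along the powers of two. -/
def DyadicallyDominated (w : ℕ → ℝ) (B : H →L[ℂ] H) : Prop :=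
  ∃ C : ℝ, 0 ≤ C ∧ ∀ j : ℕ, ∃ (F : Submodule ℂ H) (_ : FiniteDimensional ℂ F),
    Module.finrank ℂ F ≤ 2 ^ j ∧ ∀ x ∈ Fᗮ, (⟪x, B x⟫_ℂ).re ≤ C * w j * ‖x‖ ^ 2

variable {w : ℕ → ℝ}

theorem DyadicallyDominated.add {K : ℝ} (hw : ∀ j, 0 < w j) (hK : ∀ j, w j ≤ K * w (j + 1))
    {B C : H →L[ℂ] H} (hB : DyadicallyDominated w B) (hC : DyadicallyDominated w C) :
    DyadicallyDominated w (B + C) := by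
  obtain ⟨b, hb0, hb⟩ := hB
  obtain ⟨c, hc0, hc⟩ := hC
  have hK0 : 0 ≤ K := by
    by_contra! h
    have := (hw 0).trans_le (hK 0)
    nlinarith [hw 1]
  -- The sum of the two exceptional subspaces for j has dimension at most 2^(j+1), so the index
  -- shifts by one at the price of `K`. The last summand serves only index 0, which has no
  -- predecessor.
  refine ⟨(b + c) * K + ‖B + C‖ / w 0, by have := hw 0; positivity, fun j => ?_⟩
  rcases j with _ | j
  · refine ⟨⊥, inferInstance, by simp, fun x _ => (re_inner_le_opNorm _ x).trans ?_⟩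
    have h0 := hw 0
    rw [add_mul _ _ (w 0), div_mul_cancel₀ _ h0.ne']
    gcongr
    have : 0 ≤ (b + c) * K * w 0 := by positivity
    linarith
  · obtain ⟨F, hF, hFn, hFx⟩ := hb j
    obtain ⟨G, hG, hGn, hGx⟩ := hc j
    refine ⟨F ⊔ G, inferInstance, ?_, fun x hx => ?_⟩
    · have := Submodule.finrank_add_le_finrank_add_finrank F G
      rw [pow_succ]
      omega
    · have h1 := hFx x (Submodule.orthogonal_le le_sup_left hx)
      have h2 := hGx x (Submodule.orthogonal_le le_sup_right hx)
      have h3 : (b + c) * w j * ‖x‖ ^ 2 ≤ (b + c) * (K * w (j + 1)) * ‖x‖ ^ 2 := by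
        gcongr
        exact hK j
      have h4 : 0 ≤ ‖B + C‖ / w 0 * w (j + 1) * ‖x‖ ^ 2 := by
        have := hw 0; have := hw (j + 1); positivity
      rw [add_apply, inner_add_right, Complex.add_re]
      nlinarith

theorem DyadicallyDominated.mono {B C : H →L[ℂ] H} (h : ∀ x, (⟪x, B x⟫_ℂ).re ≤ (⟪x, C x⟫_ℂ).re)
    (hC : DyadicallyDominated w C) : DyadicallyDominated w B := by
  obtain ⟨c, hc0, hc⟩ := hC
  refine ⟨c, hc0, fun j => ?_⟩
  obtain ⟨F, hF, hFn, hFx⟩ := hc j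
  exact ⟨F, hF, hFn, fun x hx => (h x).trans (hFx x hx)⟩

theorem DyadicallyDominated.smul {B : H →L[ℂ] H} (hB : DyadicallyDominated w B) {c : ℝ}
    (hc : 0 ≤ c) : DyadicallyDominated w ((c : ℂ) • B) := by
  obtain ⟨b, hb0, hb⟩ := hB
  refine ⟨c * b, by positivity, fun j => ?_⟩
  obtain ⟨F, hF, hFn, hFx⟩ := hb j
  refine ⟨F, hF, hFn, fun x hx => ?_⟩
  have := mul_le_mul_of_nonneg_left (hFx x hx) hc
  simpa [inner_smul_right, mul_assoc] using this

theorem dyadicallyDominated_smul_iff {B : H →L[ℂ] H} {c : ℝ} (hc : 0 < c) :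
    DyadicallyDominated w ((c : ℂ) • B) ↔ DyadicallyDominated w B := by
  refine ⟨fun h => ?_, fun h => h.smul hc.le⟩
  have := h.smul (c := c⁻¹) (by positivity)
  rwa [smul_smul, ← Complex.ofReal_mul, inv_mul_cancel₀ hc.ne', Complex.ofReal_one, one_smul]
    at this

theorem DyadicallyDominated.of_eventually_le_zero (hw : ∀ j, 0 < w j) {B : H →L[ℂ] H}
    {F : Submodule ℂ H} [FiniteDimensional ℂ F] (h : ∀ x ∈ Fᗮ, (⟪x, B x⟫_ℂ).re ≤ 0) :
    DyadicallyDominated w B := by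
  set J := Module.finrank ℂ F
  -- For j < J the space `F` may be too large to be the exceptional one, and the norm bound is used
  -- instead.
  refine ⟨∑ j ∈ Finset.range J, ‖B‖ / w j, Finset.sum_nonneg fun j _ => by
    have := hw j; positivity, fun j => ?_⟩
  have hs : 0 ≤ ∑ j ∈ Finset.range J, ‖B‖ / w j :=
    Finset.sum_nonneg fun j _ => by have := hw j; positivity
  have hwj := hw j
  rcases lt_or_ge j J with hj | hj
  · refine ⟨⊥, inferInstance, by simp, fun x _ => (re_inner_le_opNorm _ x).trans ?_⟩
    have h1 : ‖B‖ / w j ≤ ∑ j ∈ Finset.range J, ‖B‖ / w j :=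
      Finset.single_le_sum (f := fun j => ‖B‖ / w j)
        (fun i _ => by have := hw i; positivity) (Finset.mem_range.mpr hj)
    gcongr
    rwa [div_le_iff₀ hwj] at h1
  · refine ⟨F, inferInstance, hj.trans Nat.lt_two_pow_self.le, fun x hx => (h x hx).trans ?_⟩
    positivity

theorem DyadicallyDominated.exists_kyFan_sub_le {B : H →L[ℂ] H} (hw : ∀ j, 0 < w j)
    (hB : DyadicallyDominated w B) :
    ∃ C : ℝ, 0 ≤ C ∧ ∀ j, kyFan B (2 ^ (j + 1)) - kyFan B (2 ^ j) ≤ C * (2 ^ j * w j) := by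
  obtain ⟨b, hb0, hb⟩ := hB
  refine ⟨2 * b, by positivity, fun j => ?_⟩
  obtain ⟨F, hF, hFn, hFx⟩ := hb j
  have hwj := hw j
  have := kyFan_le_add (by positivity) hFn hFx (2 ^ (j + 1))
  rw [Nat.cast_pow, Nat.cast_ofNat, pow_succ (2 : ℝ)] at this
  linarith

section Star

variable [CompleteSpace H]

theorem re_inner_star_mul_self (A : H →L[ℂ] H) (x : H) :
    (⟪x, (star A * A) x⟫_ℂ).re = ‖A x‖ ^ 2 := by
  rw [mul_apply_eq_comp, ContinuousLinearMap.star_eq_adjoint,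
    ContinuousLinearMap.adjoint_inner_right]
  exact inner_self_eq_norm_sq (𝕜 := ℂ) (A x)

theorem re_inner_mul_star_self (A : H →L[ℂ] H) (x : H) :
    (⟪x, (A * star A) x⟫_ℂ).re = ‖star A x‖ ^ 2 := by
  simpa using re_inner_star_mul_self (star A) x

/-- If y ⟂ A(F) then A*y ⟂ F. Cauchy–Schwarz gives ‖A*y‖⁴ ≤ ‖y‖² ‖AA*y‖², and the hypothesis bounds
‖AA*y‖² by c w_j ‖A*y‖²; one factor ‖A*y‖² cancels. -/
theorem DyadicallyDominated.mul_star_self (hw : ∀ j, 0 < w j) {A : H →L[ℂ] H}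
    (h : DyadicallyDominated w (star A * A)) : DyadicallyDominated w (A * star A) := by
  obtain ⟨c, hc0, hc⟩ := h
  refine ⟨c, hc0, fun j => ?_⟩
  obtain ⟨F, hF, hFn, hFx⟩ := hc j
  refine ⟨F.map (A : H →ₗ[ℂ] H), inferInstance, (Submodule.finrank_map_le _ _).trans hFn,
    fun y hy => ?_⟩
  have hmem : star A y ∈ Fᗮ := by
    rw [Submodule.mem_orthogonal']
    intro u hu
    rw [ContinuousLinearMap.star_eq_adjoint, ContinuousLinearMap.adjoint_inner_left]
    exact Submodule.inner_left_of_mem_orthogonal (Submodule.mem_map_of_mem hu) hy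
  have h1 := hFx _ hmem
  rw [re_inner_star_mul_self] at h1
  have h2 : ‖star A y‖ ^ 2 ≤ ‖y‖ * ‖A (star A y)‖ := by
    rw [← re_inner_mul_star_self]
    exact (Complex.re_le_norm _).trans (norm_inner_le_norm _ _)
  rw [re_inner_mul_star_self]
  have hwj := hw j
  rcases (norm_nonneg (star A y)).eq_or_lt with h0 | h0
  · rw [← h0, zero_pow two_ne_zero]
    positivity
  · have h3 : (‖star A y‖ ^ 2) ^ 2 ≤ ‖y‖ ^ 2 * (c * w j * ‖star A y‖ ^ 2) := by
      calc (‖star A y‖ ^ 2) ^ 2 ≤ (‖y‖ * ‖A (star A y)‖) ^ 2 := by gcongr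
        _ = ‖y‖ ^ 2 * ‖A (star A y)‖ ^ 2 := by ring
        _ ≤ _ := by gcongr
    have h4 : 0 < ‖star A y‖ ^ 2 := by positivity
    refine le_of_mul_le_mul_right ?_ h4
    linarith

theorem dyadicallyDominated_star_mul_self_iff (hw : ∀ j, 0 < w j) (A : H →L[ℂ] H) :
    DyadicallyDominated w (star A * A) ↔ DyadicallyDominated w (A * star A) := by
  refine ⟨fun h => h.mul_star_self hw, fun h => ?_⟩
  have := DyadicallyDominated.mul_star_self (A := star A) hw (by simpa using h)
  simpa using this

end Star

/-- The increments of the Ky Fan sums of `B` over dyadic windows, relative to the total weight of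
the windows. -/
noncomputable def windowRatio (w : ℕ → ℝ) (p q : ℕ → ℕ) (B : H →L[ℂ] H) (k : ℕ) : ℝ :=
  (kyFan B (2 ^ q k) - kyFan B (2 ^ p k)) / ∑ j ∈ Finset.Ico (p k) (q k), 2 ^ j * w j

open Classical in
/-- The ultralimit of the window ratios on the dominated operators, and `∞` elsewhere. -/
noncomputable def windowTrace (w : ℕ → ℝ) (p q : ℕ → ℕ) (B : H →L[ℂ] H) : ℝ≥0∞ :=
  if DyadicallyDominated w B then
    ((hyperfilter ℕ).map fun k => ENNReal.ofReal (windowRatio w p q B k)).lim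
  else ∞

variable {p q : ℕ → ℕ}

/-- `ℝ≥0∞` is compact, so the limit along an ultrafilter exists without any bound. -/
theorem windowTrace_of_dominated {B : H →L[ℂ] H} (h : DyadicallyDominated w B) :
    Tendsto (fun k => ENNReal.ofReal (windowRatio w p q B k)) (hyperfilter ℕ)
      (𝓝 (windowTrace w p q B)) := by
  rw [windowTrace, if_pos h]
  exact Ultrafilter.le_nhds_lim ((hyperfilter ℕ).map _)

theorem windowTrace_of_not_dominated {B : H →L[ℂ] H} (h : ¬ DyadicallyDominated w B) :
    windowTrace w p q B = ∞ := if_neg h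

theorem window_weight_pos (hw : ∀ j, 0 < w j) (hpq : ∀ k, p k < q k) (k : ℕ) :
    0 < ∑ j ∈ Finset.Ico (p k) (q k), 2 ^ j * w j :=
  Finset.sum_pos (fun j _ => by have := hw j; positivity) (by simpa using hpq k)

theorem windowRatio_nonneg (hw : ∀ j, 0 < w j) (hpq : ∀ k, p k < q k) (B : H →L[ℂ] H) (k : ℕ) :
    0 ≤ windowRatio w p q B k :=
  div_nonneg (sub_nonneg.mpr (kyFan_mono B (pow_le_pow_right₀ (by norm_num) (hpq k).le)))
    (window_weight_pos hw hpq k).le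

theorem windowRatio_smul {c : ℝ} (hc : 0 < c) (B : H →L[ℂ] H) (k : ℕ) :
    windowRatio w p q ((c : ℂ) • B) k = c * windowRatio w p q B k := by
  simp only [windowRatio, kyFan_smul hc]
  ring

theorem windowTrace_eq_of_tendsto {B : H →L[ℂ] H} (h : DyadicallyDominated w B) {L : ℝ≥0∞}
    (hL : Tendsto (fun k => ENNReal.ofReal (windowRatio w p q B k)) (hyperfilter ℕ) (𝓝 L)) :
    windowTrace w p q B = L :=
  tendsto_nhds_unique (windowTrace_of_dominated h) hL

theorem windowTrace_zero (hw : ∀ j, 0 < w j) : windowTrace w p q (0 : H →L[ℂ] H) = 0 := by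
  refine windowTrace_eq_of_tendsto
    (DyadicallyDominated.of_eventually_le_zero (F := ⊥) hw (by simp)) ?_
  simp [windowRatio, kyFan_zero]

theorem windowTrace_smul (hw : ∀ j, 0 < w j) (c : ℝ≥0) (B : H →L[ℂ] H) :
    windowTrace w p q (((c : ℝ) : ℂ) • B) = c * windowTrace w p q B := by
  rcases eq_or_ne c 0 with rfl | hc
  · simp [windowTrace_zero hw]
  have hc' : (0 : ℝ) < c := by positivity
  by_cases hB : DyadicallyDominated w B
  · refine windowTrace_eq_of_tendsto (hB.smul hc'.le) ?_
    simp only [windowRatio_smul hc', ENNReal.ofReal_mul hc'.le, ENNReal.ofReal_coe_nnreal]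
    exact ENNReal.Tendsto.const_mul (windowTrace_of_dominated hB) (Or.inr (by simp))
  · rw [windowTrace_of_not_dominated hB, windowTrace_of_not_dominated
      (mt (dyadicallyDominated_smul_iff hc').mp hB), ENNReal.mul_top (by simpa using hc)]

theorem windowTrace_add {K : ℝ} (hw : ∀ j, 0 < w j) (hK : ∀ j, w j ≤ K * w (j + 1))
    (hpq : ∀ k, p k < q k)
    (hp : ∀ k : ℕ, k * (2 ^ p k * w (p k)) ≤ ∑ j ∈ Finset.Ico (p k) (q k), 2 ^ j * w j)
    (hq : ∀ k : ℕ, k * (2 ^ q k * w (q k)) ≤ ∑ j ∈ Finset.Ico (p k) (q k), 2 ^ j * w j)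
    {B C : H →L[ℂ] H} (hB : B.IsPositive) (hC : C.IsPositive) :
    windowTrace w p q (B + C) = windowTrace w p q B + windowTrace w p q C := by
  by_cases hBC : DyadicallyDominated w (B + C)
  swap
  · rw [windowTrace_of_not_dominated hBC]
    by_cases hB' : DyadicallyDominated w B
    · have hC' : ¬ DyadicallyDominated w C := fun hC' => hBC (hB'.add hw hK hC')
      rw [windowTrace_of_not_dominated hC', add_top]
    · rw [windowTrace_of_not_dominated hB', top_add]
  have hB' : DyadicallyDominated w B := hBC.mono fun x => by
    have := re_inner_nonneg_of_isPositive hC x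
    rw [add_apply, inner_add_right, Complex.add_re]
    linarith
  have hC' : DyadicallyDominated w C := hBC.mono fun x => by
    have := re_inner_nonneg_of_isPositive hB x
    rw [add_apply, inner_add_right, Complex.add_re]
    linarith
  obtain ⟨D, hD0, hD⟩ := hBC.exists_kyFan_sub_le hw
  have herr : Tendsto (fun k : ℕ => ENNReal.ofReal (D / k)) (hyperfilter ℕ) (𝓝 0) := by
    have h1 : Tendsto (fun k : ℕ => D / (k : ℝ)) atTop (𝓝 0) :=
      tendsto_const_div_atTop_nhds_zero_nat D
    have h2 := (ENNReal.tendsto_ofReal h1).mono_left Nat.hyperfilter_le_atTop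
    rwa [ENNReal.ofReal_zero] at h2
  have hpos : ∀ᶠ k : ℕ in hyperfilter ℕ, 0 < k :=
    Nat.hyperfilter_le_atTop (eventually_gt_atTop 0)
  have hb : ∀ {k : ℕ} {d W : ℝ}, 0 < k → 0 < W → k * d ≤ W → D * d / W ≤ D / k := by
    intro k d W hk hW h
    have hk' : (0 : ℝ) < k := by exact_mod_cast hk
    rw [div_le_div_iff₀ hW hk']
    nlinarith
  -- The doubling is spent at the lower end: it replaces 2^p by 2^(p+1), and the extra block weighs
  -- at most D · 2^p w_p, a fraction D/k of the window.
  have hle1 : ∀ᶠ k in hyperfilter ℕ, ENNReal.ofReal (windowRatio w p q (B + C) k) ≤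
      ENNReal.ofReal (windowRatio w p q B k) + ENNReal.ofReal (windowRatio w p q C k)
        + ENNReal.ofReal (D / k) := by
    filter_upwards [hpos] with k hk
    have hW := window_weight_pos hw hpq k
    rw [← ENNReal.ofReal_add (windowRatio_nonneg hw hpq B k) (windowRatio_nonneg hw hpq C k),
      ← ENNReal.ofReal_add (add_nonneg (windowRatio_nonneg hw hpq B k)
        (windowRatio_nonneg hw hpq C k)) (by positivity)]
    refine ENNReal.ofReal_le_ofReal ?_
    refine le_trans ?_ (add_le_add_right (hb hk hW (hp k)) _)
    rw [windowRatio, windowRatio, windowRatio, ← add_div, ← add_div]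
    refine div_le_div_of_nonneg_right ?_ hW.le
    have h1 := kyFan_add_le B C (2 ^ q k)
    have h2 := kyFan_add_kyFan_le hB hC (2 ^ p k)
    have h3 := hD (p k)
    rw [← pow_succ'] at h2
    linarith
  -- The same with the doubling spent at the upper end.
  have hle2 : ∀ᶠ k in hyperfilter ℕ,
      ENNReal.ofReal (windowRatio w p q B k) + ENNReal.ofReal (windowRatio w p q C k) ≤
      ENNReal.ofReal (windowRatio w p q (B + C) k) + ENNReal.ofReal (D / k) := by
    filter_upwards [hpos] with k hk
    have hW := window_weight_pos hw hpq k
    rw [← ENNReal.ofReal_add (windowRatio_nonneg hw hpq B k) (windowRatio_nonneg hw hpq C k),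
      ← ENNReal.ofReal_add (windowRatio_nonneg hw hpq _ k) (by positivity)]
    refine ENNReal.ofReal_le_ofReal ?_
    refine le_trans ?_ (add_le_add_right (hb hk hW (hq k)) _)
    rw [windowRatio, windowRatio, windowRatio, ← add_div, ← add_div]
    refine div_le_div_of_nonneg_right ?_ hW.le
    have h1 := kyFan_add_le B C (2 ^ p k)
    have h2 := kyFan_add_kyFan_le hB hC (2 ^ q k)
    have h3 := hD (q k)
    rw [← pow_succ'] at h2
    linarith
  have tB := windowTrace_of_dominated (p := p) (q := q) hB'
  have tC := windowTrace_of_dominated (p := p) (q := q) hC'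
  have tBC := windowTrace_of_dominated (p := p) (q := q) hBC
  apply le_antisymm
  · simpa using le_of_tendsto_of_tendsto tBC ((tB.add tC).add herr) hle1
  · simpa using le_of_tendsto_of_tendsto (tB.add tC) (tBC.add herr) hle2

/-- Beyond the rank the Ky Fan sums no longer grow, and the windows eventually start there because
`k ≤ p k`. -/
theorem windowTrace_eq_zero_of_finite_rank (hw : ∀ j, 0 < w j) (hkp : ∀ k, k ≤ p k)
    {P : H →L[ℂ] H}
    (hfin : FiniteDimensional ℂ (P : H →ₗ[ℂ] H).range) : windowTrace w p q P = 0 := by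
  have hzero : ∀ x ∈ (P : H →ₗ[ℂ] H).rangeᗮ, (⟪x, P x⟫_ℂ).re ≤ 0 := by
    intro x hx
    have : ⟪x, P x⟫_ℂ = 0 :=
      Submodule.inner_left_of_mem_orthogonal (LinearMap.mem_range_self _ x) hx
    simp [this]
  refine windowTrace_eq_of_tendsto (DyadicallyDominated.of_eventually_le_zero hw hzero) ?_
  refine tendsto_const_nhds.congr' ?_
  filter_upwards [Nat.hyperfilter_le_atTop
    (eventually_ge_atTop (Module.finrank ℂ (P : H →ₗ[ℂ] H).range))] with k hk
  symm
  rw [ENNReal.ofReal_eq_zero]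
  refine div_nonpos_of_nonpos_of_nonneg ?_ (Finset.sum_nonneg fun j _ => by
    have := hw j; positivity)
  have := kyFan_le_add (B := P) (F := (P : H →ₗ[ℂ] H).range) (n := 2 ^ p k) le_rfl
    (hk.trans ((hkp k).trans Nat.lt_two_pow_self.le)) (by simpa using hzero) (2 ^ q k)
  simpa using this

variable [CompleteSpace H]

theorem windowTrace_star_mul_self (hw : ∀ j, 0 < w j) (A : H →L[ℂ] H) :
    windowTrace w p q (star A * A) = windowTrace w p q (A * star A) := by
  by_cases h : DyadicallyDominated w (star A * A)
  · refine windowTrace_eq_of_tendsto h ?_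
    simp only [windowRatio, kyFan_star_mul_self]
    exact windowTrace_of_dominated ((dyadicallyDominated_star_mul_self_iff hw A).mp h)
  · rw [windowTrace_of_not_dominated h, windowTrace_of_not_dominated
      (mt (dyadicallyDominated_star_mul_self_iff hw A).mpr h)]

/-- A positive operator whose eigenvalues at the powers of two are comparable to `w` admits a
singular trace that is finite and nonzero on it, if there are dyadic windows moving to infinity
whose total weight dominates the weights at their ends. -/
theorem exists_singular_trace {K : ℝ} (hw : ∀ j, 0 < w j) (hK : ∀ j, w j ≤ K * w (j + 1))
    (hpq : ∀ k, p k < q k) (hkp : ∀ k, k ≤ p k)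
    (hp : ∀ k : ℕ, k * (2 ^ p k * w (p k)) ≤ ∑ j ∈ Finset.Ico (p k) (q k), 2 ^ j * w j)
    (hq : ∀ k : ℕ, k * (2 ^ q k * w (q k)) ≤ ∑ j ∈ Finset.Ico (p k) (q k), 2 ^ j * w j)
    {A : H →L[ℂ] H} (hAle : DyadicallyDominated w A)
    (hAge : ∀ j, ∃ (V : Submodule ℂ H) (_ : FiniteDimensional ℂ V),
      2 ^ j ≤ Module.finrank ℂ V ∧ ∀ x ∈ V, w j * ‖x‖ ^ 2 ≤ (⟪x, A x⟫_ℂ).re) :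
    ∃ τ : TracialWeight H, τ.IsSingular ∧ τ.toFun A ≠ 0 ∧ τ.toFun A ≠ ∞ := by
  let τ : TracialWeight H :=
    { toFun := windowTrace w p q
      map_add := fun B C hB hC => windowTrace_add hw hK hpq hp hq hB hC
      map_smul := fun c B _ => windowTrace_smul hw c B
      map_star_mul_self := fun B => windowTrace_star_mul_self hw B }
  have hK0 : 0 < K := by
    by_contra! h
    have := (hw 0).trans_le (hK 0)
    nlinarith [hw 1]
  have htend := windowTrace_of_dominated (p := p) (q := q) hAle
  have htel : ∀ k, kyFan A (2 ^ q k) - kyFan A (2 ^ p k)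
      = ∑ j ∈ Finset.Ico (p k) (q k), (kyFan A (2 ^ (j + 1)) - kyFan A (2 ^ j)) := fun k =>
    (Finset.sum_Ico_sub (fun j => kyFan A (2 ^ j)) (hpq k).le).symm
  refine ⟨τ, fun P _ hfin => windowTrace_eq_zero_of_finite_rank hw hkp hfin, ?_, ?_⟩
  -- The block from 2^j to 2^(j+1) contributes at least 2^j w (j+1), which is at least K⁻¹ 2^j w j.
  · have hge : ENNReal.ofReal K⁻¹ ≤ windowTrace w p q A := by
      refine ge_of_tendsto' htend fun k => ENNReal.ofReal_le_ofReal ?_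
      rw [windowRatio, le_div_iff₀ (window_weight_pos hw hpq k), htel, Finset.mul_sum]
      refine Finset.sum_le_sum fun j _ => ?_
      obtain ⟨V, hV, hVn, hVx⟩ := hAge (j + 1)
      have h1 := kyFan_add_le_kyFan (n := 2 ^ j) (m := 2 ^ j)
        (by rwa [← two_mul, ← pow_succ']) hVx
      rw [← two_mul, ← pow_succ'] at h1
      push_cast at h1
      have h2 : K⁻¹ * (2 ^ j * w j) ≤ 2 ^ j * w (j + 1) := by
        rw [inv_mul_le_iff₀ hK0]
        have := mul_le_mul_of_nonneg_left (hK j) (by positivity : (0 : ℝ) ≤ 2 ^ j)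
        linarith
      linarith
    intro h
    have h' : windowTrace w p q A = 0 := h
    rw [h', nonpos_iff_eq_zero, ENNReal.ofReal_eq_zero] at hge
    exact absurd (inv_pos.mpr hK0) (not_lt.mpr hge)
  · obtain ⟨C, hC0, hC⟩ := hAle.exists_kyFan_sub_le hw
    have hle : windowTrace w p q A ≤ ENNReal.ofReal C := by
      refine le_of_tendsto' htend fun k => ENNReal.ofReal_le_ofReal ?_
      rw [windowRatio, div_le_iff₀ (window_weight_pos hw hpq k), htel, Finset.mul_sum]
      exact Finset.sum_le_sum fun j _ => hC j
    exact (hle.trans_lt ENNReal.ofReal_lt_top).ne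

end WindowTrace

/-! ### Diagonal operators compared with sums of copies of themselves. -/

section Diagonal

open scoped InnerProductSpace

variable {H : Type*} [NormedAddCommGroup H] [InnerProductSpace ℂ H] [CompleteSpace H]

/-- `A` is diagonal with the eigenvalues `l n` at the orthonormal vectors `e n`, and vanishes on
their orthogonal complement. -/
structure IsDiagonal (A : H →L[ℂ] H) (e : ℕ → H) (l : ℕ → ℝ) : Prop where
  orthonormal : Orthonormal ℂ e
  apply : ∀ n, A (e n) = (l n : ℂ) • e n
  apply_eq_zero : ∀ x, (∀ n, ⟪e n, x⟫_ℂ = 0) → A x = 0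

variable {A : H →L[ℂ] H} {e : ℕ → H} {l : ℕ → ℝ}

theorem Orthonormal.summable_inner_smul (he : Orthonormal ℂ e) (x : H) :
    Summable fun n => ⟪e n, x⟫_ℂ • e n := by
  have h := (he.orthogonalFamily.summable_iff_norm_sq_summable (fun n => ⟪e n, x⟫_ℂ)).mpr
    (he.inner_products_summable x)
  simpa using h

theorem Orthonormal.inner_tsum_inner_smul (he : Orthonormal ℂ e) (x : H) (n : ℕ) :
    ⟪e n, ∑' m, ⟪e m, x⟫_ℂ • e m⟫_ℂ = ⟪e n, x⟫_ℂ := by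
  have h := (innerSL ℂ (e n)).hasSum (he.summable_inner_smul x).hasSum
  have h2 : HasSum (fun m => innerSL ℂ (e n) (⟪e m, x⟫_ℂ • e m)) ⟪e n, x⟫_ℂ := by
    convert hasSum_ite_eq n ⟪e n, x⟫_ℂ using 2 with m
    simp only [innerSL_apply_apply, inner_smul_right, orthonormal_iff_ite.mp he]
    by_cases hm : m = n
    · simp [hm]
    · simp [hm, Ne.symm hm]
  exact h.unique h2

namespace IsDiagonal

theorem hasSum_apply (h : IsDiagonal A e l) (x : H) :
    HasSum (fun n => (⟪e n, x⟫_ℂ * l n) • e n) (A x) := by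
  have h1 : A x = A (∑' m, ⟪e m, x⟫_ℂ • e m) := by
    rw [← sub_eq_zero, ← map_sub]
    refine h.apply_eq_zero _ fun n => ?_
    rw [inner_sub_right, h.orthonormal.inner_tsum_inner_smul, sub_self]
  rw [h1]
  have h2 := A.hasSum (h.orthonormal.summable_inner_smul x).hasSum
  simpa only [map_smul, h.apply, smul_smul] using h2

theorem hasSum_re_inner (h : IsDiagonal A e l) (x : H) :
    HasSum (fun n => l n * ‖⟪e n, x⟫_ℂ‖ ^ 2) (⟪x, A x⟫_ℂ).re := by
  have h1 := Complex.reCLM.hasSum ((innerSL ℂ x).hasSum (h.hasSum_apply x))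
  convert h1 using 2 with n
  swap
  · rfl
  simp only [innerSL_apply_apply, inner_smul_right, Complex.reCLM_apply]
  rw [← inner_conj_symm x (e n), mul_right_comm, Complex.mul_conj, Complex.normSq_eq_norm_sq,
    ← Complex.ofReal_mul, Complex.ofReal_re, mul_comm]

end IsDiagonal

/-- `U` is I J*, where J and I are the isometries of ℓ² onto the closed spans of `e` and `v`. -/
theorem exists_partial_isometry {v : ℕ → H} (he : Orthonormal ℂ e) (hv : Orthonormal ℂ v) :
    ∃ U : H →L[ℂ] H, (∀ n, U (e n) = v n) ∧ (∀ n, star U (v n) = e n) ∧ U * star U * U = U := by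
  let J : lp (fun _ : ℕ => ℂ) 2 →L[ℂ] H :=
    he.orthogonalFamily.linearIsometry.toContinuousLinearMap
  let I : lp (fun _ : ℕ => ℂ) 2 →L[ℂ] H :=
    hv.orthogonalFamily.linearIsometry.toContinuousLinearMap
  have hJ : ∀ n, J (lp.single 2 n 1) = e n := fun n => by
    refine (he.orthogonalFamily.linearIsometry_apply_single (i := n) (1 : ℂ)).trans ?_
    simp
  have hI : ∀ n, I (lp.single 2 n 1) = v n := fun n => by
    refine (hv.orthogonalFamily.linearIsometry_apply_single (i := n) (1 : ℂ)).trans ?_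
    simp
  have hJJ : ∀ y, ContinuousLinearMap.adjoint J (J y) = y := fun y =>
    congr($((ContinuousLinearMap.norm_map_iff_adjoint_comp_self J).mp
      he.orthogonalFamily.linearIsometry.norm_map) y)
  have hII : ∀ y, ContinuousLinearMap.adjoint I (I y) = y := fun y =>
    congr($((ContinuousLinearMap.norm_map_iff_adjoint_comp_self I).mp
      hv.orthogonalFamily.linearIsometry.norm_map) y)
  have hstar : star (I ∘L ContinuousLinearMap.adjoint J) = J ∘L ContinuousLinearMap.adjoint I := by
    rw [ContinuousLinearMap.star_eq_adjoint, ContinuousLinearMap.adjoint_comp,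
      ContinuousLinearMap.adjoint_adjoint]
  refine ⟨I ∘L ContinuousLinearMap.adjoint J, fun n => ?_, fun n => ?_, ?_⟩
  · simp [← hJ, hJJ, hI]
  · simp [hstar, ← hI, hII, hJ]
  · ext x
    simp [hstar, hII, hJJ]

namespace TracialWeight

variable (τ : TracialWeight H)

theorem map_zero : τ.toFun 0 = 0 := by
  simpa using τ.map_smul 0 0 ContinuousLinearMap.isPositive_zero

theorem map_sum {ι : Type*} (s : Finset ι) {B : ι → H →L[ℂ] H} (hB : ∀ i, (B i).IsPositive) :
    τ.toFun (∑ i ∈ s, B i) = ∑ i ∈ s, τ.toFun (B i) := by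
  classical
  induction s using Finset.induction_on with
  | empty => simpa using τ.map_zero
  | insert i s hi ih =>
    rw [Finset.sum_insert hi, Finset.sum_insert hi, τ.map_add _ _ (hB i), ih]
    exact ContinuousLinearMap.isPositive_sum s fun i _ => hB i

theorem mono {A B : H →L[ℂ] H} (hA : A.IsPositive) (hB : B.IsPositive)
    (h : ∀ x, (⟪x, A x⟫_ℂ).re ≤ (⟪x, B x⟫_ℂ).re) : τ.toFun A ≤ τ.toFun B := by
  have hBA : (B - A).IsPositive := by
    refine ⟨hB.isSymmetric.sub hA.isSymmetric, fun x => ?_⟩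
    rw [ContinuousLinearMap.reApplyInnerSelf_apply, inner_re_symm]
    have := h x
    simp only [sub_apply, inner_sub_right, RCLike.re_to_complex, Complex.sub_re]
    linarith
  have := τ.map_add A (B - A) hA hBA
  rw [add_sub_cancel] at this
  rw [this]
  exact le_self_add

/-- With R = √A, the operator UAU* is (UR)(UR)*, while (UR)*(UR) = R U*U R = A because U*U fixes the
range of R. -/
theorem map_partial_isometry_conj (hA : A.IsPositive) (hd : IsDiagonal A e l) {U : H →L[ℂ] H}
    {v : ℕ → H} (hU : ∀ n, U (e n) = v n) (hUs : ∀ n, star U (v n) = e n)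
    (hUU : U * star U * U = U) : τ.toFun (U * A * star U) = τ.toFun A := by
  set R := CFC.sqrt A
  have hA0 : 0 ≤ A := (ContinuousLinearMap.nonneg_iff_isPositive A).mpr hA
  have hRR : R * R = A := CFC.sqrt_mul_sqrt_self A hA0
  have hR : star R = R := (CFC.sqrt_nonneg A).isSelfAdjoint
  -- The defect z' is orthogonal to all `e n`, so A z' = 0 and R z' = 0, whence z' is orthogonal to
  -- the range of R, which contains z. Also U z' = 0, so z' is orthogonal to U*U z. Thus z' is
  -- orthogonal to itself.
  have hfix : star U * U * R = R := by
    ext x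
    set z := R x
    set z' := z - (star U * U) z with hz'
    have h1 : ∀ n, ⟪e n, z'⟫_ℂ = 0 := by
      intro n
      have h0 : ⟪v n, U z⟫_ℂ = ⟪e n, z⟫_ℂ := by
        rw [← ContinuousLinearMap.adjoint_inner_left, ← ContinuousLinearMap.star_eq_adjoint, hUs]
      rw [hz', inner_sub_right, mul_apply_eq_comp, ContinuousLinearMap.star_eq_adjoint,
        ContinuousLinearMap.adjoint_inner_right, hU, h0, sub_self]
    have h2 : R z' = 0 := by
      have h3 := re_inner_star_mul_self R z'
      rw [hR, hRR, hd.apply_eq_zero z' h1, inner_zero_right, Complex.zero_re] at h3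
      have : ‖R z'‖ = 0 := by nlinarith [norm_nonneg (R z')]
      simpa using this
    have h4 : U z' = 0 := by
      rw [hz', map_sub, sub_eq_zero]
      exact congr($hUU.symm z)
    have h5 : ⟪z', z'⟫_ℂ = 0 := by
      have h0 : ⟪(star U * U) z, z'⟫_ℂ = 0 := by
        rw [mul_apply_eq_comp, ContinuousLinearMap.star_eq_adjoint,
          ContinuousLinearMap.adjoint_inner_left, h4, inner_zero_right]
      rw [show ⟪z', z'⟫_ℂ = ⟪z, z'⟫_ℂ - ⟪(star U * U) z, z'⟫_ℂ from inner_sub_left _ _ _, h0,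
        sub_zero]
      calc ⟪z, z'⟫_ℂ = ⟪x, star R z'⟫_ℂ := by
            rw [ContinuousLinearMap.star_eq_adjoint, ContinuousLinearMap.adjoint_inner_right]
        _ = 0 := by rw [hR, h2, inner_zero_right]
    have h6 : z' = 0 := inner_self_eq_zero.mp h5
    exact (sub_eq_zero.mp h6).symm
  have h1 := τ.map_star_mul_self (U * R)
  have h2 : star (U * R) * (U * R) = A := by
    rw [star_mul, hR, mul_assoc, ← mul_assoc (star U), hfix, hRR]
  have h3 : U * R * star (U * R) = U * A * star U := by
    rw [star_mul, hR, ← hRR]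
    simp only [mul_assoc]
  rw [← h3, ← h1, h2]

end TracialWeight

/-- The sum of the copies of the diagonal operator `A` along the orthonormal families `v j`. -/
theorem exists_sum_copies (hA : A.IsPositive) (hd : IsDiagonal A e l) {k : ℕ}
    {v : Fin k → ℕ → H} (hv : ∀ j, Orthonormal ℂ (v j)) :
    ∃ B : H →L[ℂ] H, B.IsPositive ∧ (∀ τ : TracialWeight H, τ.toFun B = k * τ.toFun A) ∧
      ∀ x, HasSum (fun i => ∑ j, l i * ‖⟪v j i, x⟫_ℂ‖ ^ 2) (⟪x, B x⟫_ℂ).re := by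
  choose U hU hUs hUU using fun j => exists_partial_isometry hd.orthonormal (hv j)
  have hpos : ∀ j, (U j * A * star (U j)).IsPositive := fun j => hA.conj_adjoint (U j)
  refine ⟨∑ j, U j * A * star (U j), ContinuousLinearMap.isPositive_sum _ fun j _ => hpos j,
    fun τ => ?_, fun x => ?_⟩
  · rw [τ.map_sum _ hpos]
    simp [τ.map_partial_isometry_conj hA hd (hU _) (hUs _) (hUU _)]
  · rw [sum_apply, inner_sum, Complex.re_sum]
    refine hasSum_sum fun j _ => ?_
    have h1 := hd.hasSum_re_inner (star (U j) x)
    have h2 : ∀ n, ⟪e n, star (U j) x⟫_ℂ = ⟪v j n, x⟫_ℂ := fun n => by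
      rw [ContinuousLinearMap.star_eq_adjoint, ContinuousLinearMap.adjoint_inner_right, hU]
    have h3 : ⟪star (U j) x, A (star (U j) x)⟫_ℂ = ⟪x, (U j * A * star (U j)) x⟫_ℂ := by
      rw [ContinuousLinearMap.star_eq_adjoint, ContinuousLinearMap.adjoint_inner_left]
      rfl
    simpa only [h2, h3] using h1

theorem HasSum.sum_residues {g : ℕ → ℝ} {S : ℝ} (h : HasSum g S) {k : ℕ} [NeZero k] :
    HasSum (fun i => ∑ j : Fin k, g (k * i + j)) S := by
  have h1 : HasSum (g ∘ (Nat.divModEquiv k).symm) S := (Equiv.hasSum_iff _).mpr h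
  have h2 := h1.prod_fiberwise
    (g := fun i => ∑ j : Fin k, (g ∘ (Nat.divModEquiv k).symm) (i, j)) fun i => hasSum_fintype _
  simpa [Nat.divModEquiv, mul_comm] using h2

/-- `c` times the copies of `A` on the residue classes modulo `k` lies below `A`, so ck τ(A) ≤ τ(A).
-/
theorem TracialWeight.eq_zero_or_top_of_slow_decay (τ : TracialWeight H) (hA : A.IsPositive)
    (hd : IsDiagonal A e l) {k : ℕ} {c : ℝ≥0} (hck : 1 < c * k)
    (hl : ∀ i, ∀ j < k, c * l i ≤ l (k * i + j)) : τ.toFun A = 0 ∨ τ.toFun A = ∞ := by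
  have hk : NeZero k := ⟨by rintro rfl; simp at hck⟩
  have hv : ∀ j : Fin k, Orthonormal ℂ fun i => e (k * i + j) := fun j =>
    hd.orthonormal.comp _ fun a b hab => by
      have hab' : k * a + j = k * b + j := hab
      exact Nat.eq_of_mul_eq_mul_left (NeZero.pos k) (Nat.add_right_cancel hab')
  obtain ⟨B, hB, hτ, hsum⟩ := exists_sum_copies hA hd hv
  have hcB : (((c : ℝ) : ℂ) • B).IsPositive := hB.smul_of_nonneg (by
    rw [Complex.zero_le_real]; positivity)
  have hle : τ.toFun (((c : ℝ) : ℂ) • B) ≤ τ.toFun A := by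
    refine τ.mono hcB hA fun x => ?_
    have h1 := (hsum x).mul_left (c : ℝ)
    have h2 := (hd.hasSum_re_inner x).sum_residues (k := k)
    have h3 : (⟪x, (((c : ℝ) : ℂ) • B) x⟫_ℂ).re = c * (⟪x, B x⟫_ℂ).re := by
      simp
    rw [h3]
    refine hasSum_le (fun i => ?_) h1 h2
    rw [Finset.mul_sum]
    refine Finset.sum_le_sum fun j _ => ?_
    rw [← mul_assoc]
    gcongr
    exact hl i j j.2
  rw [τ.map_smul c B hB, hτ, ← mul_assoc] at hle
  by_contra! hne
  have hck' : (1 : ℝ≥0∞) < c * k := by exact_mod_cast hck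
  have := ENNReal.mul_lt_mul_left hne.1 hne.2 hck'
  rw [one_mul] at this
  exact absurd hle (not_le.mpr this)

/-- The copies start at index `N`; `c` times their sum dominates `A` off the first `N` eigenvectors,
and these are absorbed by a multiple of a finite rank projection, on which `τ` vanishes. So τ(A) ≤
ck τ(A). -/
theorem TracialWeight.eq_zero_or_top_of_fast_decay {τ : TracialWeight H} (hτ : τ.IsSingular)
    (hA : A.IsPositive) (hl0 : ∀ i, 0 ≤ l i)
    (hd : IsDiagonal A e l) {k N : ℕ} {c : ℝ≥0} (hk : 0 < k) (hck : c * k < 1)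
    (hl : ∀ i, ∀ j < k, l (k * i + j + N) ≤ c * l i) : τ.toFun A = 0 ∨ τ.toFun A = ∞ := by
  have hk' : NeZero k := ⟨hk.ne'⟩
  have hv : ∀ j : Fin k, Orthonormal ℂ fun i => e (k * i + j + N) := fun j =>
    hd.orthonormal.comp _ fun a b hab => by
      have hab' : k * a + j + N = k * b + j + N := hab
      exact Nat.eq_of_mul_eq_mul_left hk (Nat.add_right_cancel (Nat.add_right_cancel hab'))
  obtain ⟨B, hB, hτB, hsum⟩ := exists_sum_copies hA hd hv
  have hcB : (((c : ℝ) : ℂ) • B).IsPositive := hB.smul_of_nonneg (by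
    rw [Complex.zero_le_real]; positivity)
  let E : Submodule ℂ H := Submodule.span ℂ (Set.range fun m : Fin N => e m)
  have hEfin : FiniteDimensional ℂ E := FiniteDimensional.span_of_finite ℂ (Set.finite_range _)
  let P : H →L[ℂ] H := E.starProjection
  have hP : IsStarProjection P := isStarProjection_starProjection
  have hPpos : P.IsPositive := ContinuousLinearMap.IsPositive.of_isStarProjection hP
  have hPre : ∀ x, ∑ m ∈ Finset.range N, ‖⟪e m, x⟫_ℂ‖ ^ 2 ≤ (⟪x, P x⟫_ℂ).re := by
    intro x
    have h1 : (⟪x, P x⟫_ℂ).re = ‖P x‖ ^ 2 := by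
      have := re_inner_star_mul_self P x
      rwa [hP.isSelfAdjoint.star_eq, hP.isIdempotentElem.eq] at this
    have h2 : ∀ m ∈ Finset.range N, ⟪e m, x⟫_ℂ = ⟪e m, P x⟫_ℂ := by
      intro m hm
      have hmE : e m ∈ E := Submodule.subset_span ⟨⟨m, Finset.mem_range.mp hm⟩, rfl⟩
      rw [← Submodule.inner_starProjection_left_eq_right,
        Submodule.starProjection_eq_self_iff.mpr hmE]
    rw [h1, Finset.sum_congr rfl fun m hm => by rw [h2 m hm]]
    exact hd.orthonormal.sum_inner_products_le _
  have hPτ : τ.toFun P = 0 := hτ P hP (by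
    have : (P : H →ₗ[ℂ] H).range = E := E.range_starProjection
    rw [this]; exact hEfin)
  -- `M` only has to bound each of the first `N` eigenvalues.
  let M : ℝ≥0 := ⟨∑ m ∈ Finset.range N, l m, Finset.sum_nonneg fun m _ => hl0 m⟩
  have hMP : (((M : ℝ) : ℂ) • P).IsPositive := hPpos.smul_of_nonneg (by
    rw [Complex.zero_le_real]; positivity)
  have hle : τ.toFun A ≤ τ.toFun (((M : ℝ) : ℂ) • P + ((c : ℝ) : ℂ) • B) := by
    refine τ.mono hA (hMP.add hcB) fun x => ?_
    have h1 := (hsum x).mul_left (c : ℝ)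
    have h2 := ((hasSum_nat_add_iff' N).mpr (hd.hasSum_re_inner x)).sum_residues (k := k)
    have h3 : (⟪x, (((M : ℝ) : ℂ) • P + ((c : ℝ) : ℂ) • B) x⟫_ℂ).re
        = M * (⟪x, P x⟫_ℂ).re + c * (⟪x, B x⟫_ℂ).re := by
      simp
    rw [h3]
    have h4 : ∑ m ∈ Finset.range N, l m * ‖⟪e m, x⟫_ℂ‖ ^ 2 ≤ M * (⟪x, P x⟫_ℂ).re := by
      calc ∑ m ∈ Finset.range N, l m * ‖⟪e m, x⟫_ℂ‖ ^ 2
          ≤ ∑ m ∈ Finset.range N, M * ‖⟪e m, x⟫_ℂ‖ ^ 2 := by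
            refine Finset.sum_le_sum fun m hm => ?_
            gcongr
            exact Finset.single_le_sum (f := l) (fun i _ => hl0 i) hm
        _ = M * ∑ m ∈ Finset.range N, ‖⟪e m, x⟫_ℂ‖ ^ 2 := by rw [Finset.mul_sum]
        _ ≤ _ := by gcongr; exact hPre x
    have h5 := hasSum_le (fun i => ?_) h2 h1
    · linarith
    rw [Finset.mul_sum]
    refine Finset.sum_le_sum fun j _ => ?_
    rw [← mul_assoc]
    gcongr
    exact hl i j j.2
  rw [τ.map_add _ _ hMP hcB, τ.map_smul M P hPpos, hPτ, mul_zero, zero_add,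
    τ.map_smul c B hB, hτB, ← mul_assoc] at hle
  by_contra! hne
  have hck' : (c * k : ℝ≥0∞) < 1 := by exact_mod_cast hck
  have := ENNReal.mul_lt_mul_left hne.1 hne.2 hck'
  rw [one_mul] at this
  exact absurd hle (not_le.mpr this)

end Diagonal

/-! ### Diagonalisation of compact operators with simple positive spectrum, and their powers. -/

section Diagonalisation

open scoped InnerProductSpace
open Module.End

variable {H : Type*} [NormedAddCommGroup H] [InnerProductSpace ℂ H]

theorem eigenspace_le_spectralSubspaceGE (B : H →L[ℂ] H) {r s : ℝ} (h : r ≤ s) :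
    eigenspace (B : H →ₗ[ℂ] H) (s : ℂ) ≤ spectralSubspaceGE B r :=
  le_iSup₂_of_le s h le_rfl

theorem spectralSubspaceGE_antitone (B : H →L[ℂ] H) : Antitone (spectralSubspaceGE B) :=
  fun _ _ h => iSup₂_le fun _ hs => eigenspace_le_spectralSubspaceGE B (h.trans hs)

/-- Pythagoras: the eigenspaces are mutually orthogonal and `B` stretches each component by at least
`r`. -/
theorem le_norm_apply_of_mem_spectralSubspaceGE {B : H →L[ℂ] H}
    (hB : (B : H →ₗ[ℂ] H).IsSymmetric) {r : ℝ} (hr : 0 ≤ r) {x : H}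
    (hx : x ∈ spectralSubspaceGE B r) : r * ‖x‖ ≤ ‖B x‖ := by
  rw [spectralSubspaceGE, iSup_subtype', Submodule.mem_iSup_iff_exists_finsupp] at hx
  obtain ⟨f, hf, rfl⟩ := hx
  have hfam := hB.orthogonalFamily_eigenspaces.comp
    (f := fun s : Set.Ici r => ((s : ℝ) : ℂ)) fun a b h => by simpa [Subtype.ext_iff] using h
  let l : ∀ s : Set.Ici r, eigenspace (B : H →ₗ[ℂ] H) ((s : ℝ) : ℂ) := fun s => ⟨f s, hf s⟩
  let m : ∀ s : Set.Ici r, eigenspace (B : H →ₗ[ℂ] H) ((s : ℝ) : ℂ) := fun s =>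
    ((s : ℝ) : ℂ) • l s
  have h1 : ‖f.sum fun _ xi => xi‖ ^ 2 = ∑ s ∈ f.support, ‖f s‖ ^ 2 := hfam.norm_sum l f.support
  have h2 : ‖B (f.sum fun _ xi => xi)‖ ^ 2 = ∑ s ∈ f.support, ((s : ℝ) * ‖f s‖) ^ 2 := by
    have h3 := hfam.norm_sum m f.support
    have h4 : B (f.sum fun _ xi => xi) = ∑ s ∈ f.support, ((s : ℝ) : ℂ) • f s := by
      rw [Finsupp.sum, map_sum]
      exact Finset.sum_congr rfl fun s _ => mem_eigenspace_iff.mp (hf s)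
    rw [h4]
    refine h3.trans (Finset.sum_congr rfl fun s _ => ?_)
    have hs : (0 : ℝ) ≤ s := hr.trans s.2
    change ‖((s : ℝ) : ℂ) • f s‖ ^ 2 = _
    rw [norm_smul, Complex.norm_real, Real.norm_of_nonneg hs]
  have h5 : (r * ‖f.sum fun _ xi => xi‖) ^ 2 ≤ ‖B (f.sum fun _ xi => xi)‖ ^ 2 := by
    rw [mul_pow, h1, h2, Finset.mul_sum]
    refine Finset.sum_le_sum fun s _ => ?_
    have hs : r ≤ s := s.2
    rw [← mul_pow]
    gcongr
  exact (pow_le_pow_iff_left₀ (by positivity) (norm_nonneg _) two_ne_zero).mp h5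

theorem eigenspace_isOrtho_spectralSubspaceGE {B : H →L[ℂ] H}
    (hB : (B : H →ₗ[ℂ] H).IsSymmetric) {s r : ℝ} (h : s < r) :
    eigenspace (B : H →ₗ[ℂ] H) (s : ℂ) ⟂ spectralSubspaceGE B r := by
  rw [Submodule.isOrtho_comm, Submodule.isOrtho_iff_le]
  refine iSup₂_le fun t ht x hx => ?_
  rw [Submodule.mem_orthogonal]
  intro y hy
  have hne : (s : ℂ) ≠ (t : ℂ) := by
    intro hst
    have : s = t := by exact_mod_cast hst
    exact absurd (h.trans_le ht) (by simp [this])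
  exact hB.orthogonalFamily_eigenspaces hne ⟨y, hy⟩ ⟨x, hx⟩

variable [CompleteSpace H]

/-- On the closure of the subspace `B` is compact and bounded below, so the closed unit ball there
is compact and Riesz's theorem applies. -/
theorem finiteDimensional_spectralSubspaceGE {B : H →L[ℂ] H} (hc : IsCompactOperator B)
    (hB : (B : H →ₗ[ℂ] H).IsSymmetric) {r : ℝ} (hr : 0 < r) :
    FiniteDimensional ℂ (spectralSubspaceGE B r) := by
  let K := (spectralSubspaceGE B r).topologicalClosure
  have hK : IsClosed (K : Set H) := Submodule.isClosed_topologicalClosure _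
  have : CompleteSpace K := hK.completeSpace_coe
  have hlow : ∀ x ∈ K, r * ‖x‖ ≤ ‖B x‖ := by
    have hcl : IsClosed {x : H | r * ‖x‖ ≤ ‖B x‖} :=
      isClosed_le (by fun_prop) (by fun_prop)
    exact fun x hx => closure_minimal
      (fun y hy => le_norm_apply_of_mem_spectralSubspaceGE hB hr.le hy) hcl hx
  let C : K →L[ℂ] H := B.comp K.subtypeL
  have hC : IsCompactOperator C := hc.comp_clm K.subtypeL
  have hanti : AntilipschitzWith (Real.toNNReal r⁻¹) C := by
    refine C.antilipschitz_of_bound fun x => ?_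
    rw [Real.coe_toNNReal _ (by positivity), ← div_eq_inv_mul, le_div_iff₀ hr, mul_comm]
    exact hlow x x.2
  have hemb := hanti.isClosedEmbedding C.uniformContinuous
  obtain ⟨Q, hQ, hQsub⟩ := hC.image_closedBall_subset_compact (f := (C : K →ₗ[ℂ] H)) 1
  have hball : IsCompact (Metric.closedBall (0 : K) 1) :=
    (hemb.isCompact_preimage hQ).of_isClosed_subset Metric.isClosed_closedBall
      fun x hx => hQsub ⟨x, hx, rfl⟩
  have : FiniteDimensional ℂ K := FiniteDimensional.of_isCompact_closedBall ℂ one_pos hball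
  exact Submodule.finiteDimensional_of_le (Submodule.le_topologicalClosure _)

/-- A positive compact operator whose eigenvalues, counted with multiplicity, form a strictly
decreasing sequence of positive numbers, is diagonal with these eigenvalues. -/
theorem exists_isDiagonal {B : H →L[ℂ] H} (hc : IsCompactOperator B) (hB : B.IsPositive)
    {μ : ℕ → ℝ} (hpos : ∀ n, 0 < μ n) (hanti : StrictAnti μ)
    (hμ : ∀ n, sSup {r : ℝ | 0 < r ∧ n + 1 ≤ Module.finrank ℂ (spectralSubspaceGE B r)} = μ n) :
    ∃ e : ℕ → H, IsDiagonal B e μ := by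
  classical
  have hsymm : (B : H →ₗ[ℂ] H).IsSymmetric := hB.isSymmetric
  have hfin : ∀ {r : ℝ}, 0 < r → FiniteDimensional ℂ (spectralSubspaceGE B r) := fun hr =>
    finiteDimensional_spectralSubspaceGE hc hsymm hr
  set N : ℝ → ℕ := fun r => Module.finrank ℂ (spectralSubspaceGE B r)
  have hN : ∀ {r s : ℝ}, 0 < r → r ≤ s → N s ≤ N r := fun {r s} hr hrs => by
    have := hfin hr
    exact Submodule.finrank_mono (spectralSubspaceGE_antitone B hrs)
  have hbdd : ∀ n, BddAbove {r : ℝ | 0 < r ∧ n + 1 ≤ N r} := by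
    refine fun n => ⟨‖B‖, ?_⟩
    rintro r ⟨hr, hn⟩
    have hnt : Nontrivial (spectralSubspaceGE B r) :=
      Module.nontrivial_of_finrank_pos (R := ℂ) ((Nat.succ_pos n).trans_le hn)
    obtain ⟨⟨x, hx⟩, hx0⟩ := exists_ne (0 : spectralSubspaceGE B r)
    have hx0' : 0 < ‖x‖ := by simpa [Subtype.ext_iff] using hx0
    exact le_of_mul_le_mul_right ((le_norm_apply_of_mem_spectralSubspaceGE hsymm hr.le hx).trans
      (B.le_opNorm x)) hx0'
  have hle : ∀ {n : ℕ} {r : ℝ}, 0 < r → n + 1 ≤ N r → r ≤ μ n := fun {n r} hr h => by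
    rw [← hμ n]
    exact le_csSup (hbdd n) ⟨hr, h⟩
  have hge : ∀ {n : ℕ} {r : ℝ}, 0 < r → r < μ n → n + 1 ≤ N r := fun {n r} hr h => by
    -- The supremum of the empty set is 0 by convention, which `hpos` excludes.
    have hne : {r : ℝ | 0 < r ∧ n + 1 ≤ N r}.Nonempty := by
      by_contra! he
      have := hμ n
      rw [he, Real.sSup_empty] at this
      exact (hpos n).ne this
    obtain ⟨s, ⟨_, hsn⟩, hs⟩ := exists_lt_of_lt_csSup hne (show r < sSup _ by rw [hμ n]; exact h)
    exact hsn.trans (hN hr hs.le)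
  have hdim : ∀ {s t : ℝ}, 0 < s → s < t →
      Module.finrank ℂ (eigenspace (B : H →ₗ[ℂ] H) (s : ℂ)) + N t ≤ N s := by
    intro s t hs hst
    have := hfin hs
    have := hfin (hs.trans hst)
    have hsub := eigenspace_le_spectralSubspaceGE B (le_refl s)
    have : FiniteDimensional ℂ (eigenspace (B : H →ₗ[ℂ] H) (s : ℂ)) :=
      Submodule.finiteDimensional_of_le hsub
    have h1 := Submodule.finrank_sup_add_finrank_inf_eq (eigenspace (B : H →ₗ[ℂ] H) (s : ℂ))
      (spectralSubspaceGE B t)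
    rw [(eigenspace_isOrtho_spectralSubspaceGE hsymm hst).disjoint.eq_bot, finrank_bot,
      add_zero] at h1
    rw [← h1]
    exact Submodule.finrank_mono (sup_le hsub (spectralSubspaceGE_antitone B hst.le))
  -- `N` drops just above an eigenvalue `s`, so `s` is the value of `μ` at the last index counted by
  -- `N s`; the 1 is subtracted because `μ` starts at index 0.
  have heig : ∀ {s : ℝ}, 0 < s → eigenspace (B : H →ₗ[ℂ] H) (s : ℂ) ≠ ⊥ → ∃ n, s = μ n := by
    intro s hs hne
    have := hfin hs
    have hfd : FiniteDimensional ℂ (eigenspace (B : H →ₗ[ℂ] H) (s : ℂ)) :=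
      Submodule.finiteDimensional_of_le (eigenspace_le_spectralSubspaceGE B (le_refl s))
    have h1 : 1 ≤ Module.finrank ℂ (eigenspace (B : H →ₗ[ℂ] H) (s : ℂ)) :=
      Submodule.one_le_finrank_iff.mpr hne
    have h2 := hdim hs (lt_add_one s)
    refine ⟨N s - 1, le_antisymm (hle hs (by omega)) ?_⟩
    by_contra! hlt
    obtain ⟨t, hst, ht⟩ := exists_between hlt
    have h3 := hdim hs hst
    have h4 := hge (hs.trans hst) ht
    omega
  have hone : ∀ n, Module.finrank ℂ (eigenspace (B : H →ₗ[ℂ] H) (μ n : ℂ)) ≤ 1 := by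
    intro n
    have hN' : N (μ n) ≤ n + 1 := by
      by_contra! h
      exact absurd (hle (n := n + 1) (hpos n) h) (not_le.mpr (hanti (Nat.lt_succ_self n)))
    rcases n with _ | n
    · have := hdim (hpos 0) (lt_add_one _)
      omega
    · obtain ⟨t, hst, ht⟩ := exists_between (hanti (Nat.lt_succ_self n))
      have h3 := hdim (hpos (n + 1)) hst
      have h4 := hge ((hpos _).trans hst) ht
      omega
  have hspan : ∀ n, ∃ u : H, eigenspace (B : H →ₗ[ℂ] H) (μ n : ℂ) = Submodule.span ℂ {u} := by
    intro n
    have := hfin (hpos n)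
    have hfd : FiniteDimensional ℂ (eigenspace (B : H →ₗ[ℂ] H) (μ n : ℂ)) :=
      Submodule.finiteDimensional_of_le (eigenspace_le_spectralSubspaceGE B (le_refl _))
    have := (Submodule.finrank_le_one_iff_isPrincipal _).mp (hone n)
    exact this.principal
  choose u hu using hspan
  -- If the eigenspace of `μ n` were zero, then for t between μ (n+1) and μ n the spectral subspace,
  -- of dimension at least n + 1, would be spanned by u 0, …, u (n-1).
  have hune : ∀ n, u n ≠ 0 := by
    intro n h0
    obtain ⟨t, ht, ht'⟩ := exists_between (hanti (Nat.lt_succ_self n))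
    have htpos := (hpos _).trans ht
    have h1 : spectralSubspaceGE B t ≤ Submodule.span ℂ ((Finset.range n).image u : Set H) := by
      refine iSup₂_le fun s hs => ?_
      by_cases hbot : eigenspace (B : H →ₗ[ℂ] H) (s : ℂ) = ⊥
      · rw [hbot]
        exact bot_le
      obtain ⟨m, rfl⟩ := heig (htpos.trans_le hs) hbot
      have hmn : m < n := by
        have h2 : m < n + 1 := hanti.lt_iff_gt.mp (ht.trans_le hs)
        refine lt_of_le_of_ne (Nat.lt_succ_iff.mp h2) ?_
        rintro rfl
        exact hbot (by rw [hu, h0]; simp)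
      rw [hu, Submodule.span_le, Set.singleton_subset_iff]
      exact Submodule.subset_span (by
        rw [Finset.mem_coe, Finset.mem_image]
        exact ⟨m, Finset.mem_range.mpr hmn, rfl⟩)
    have h2 : N t ≤ n := by
      calc N t ≤ Module.finrank ℂ (Submodule.span ℂ ((Finset.range n).image u : Set H)) :=
            Submodule.finrank_mono h1
        _ ≤ ((Finset.range n).image u).card := finrank_span_finset_le_card _
        _ ≤ n := Finset.card_image_le.trans (by simp)
    have := hge htpos ht'
    omega
  let e : ℕ → H := fun n => ((‖u n‖⁻¹ : ℝ) : ℂ) • u n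
  have hemem : ∀ n, e n ∈ eigenspace (B : H →ₗ[ℂ] H) (μ n : ℂ) := fun n => by
    rw [hu]
    exact Submodule.smul_mem _ _ (Submodule.mem_span_singleton_self _)
  have hspan_e : ∀ n, ∀ y ∈ eigenspace (B : H →ₗ[ℂ] H) (μ n : ℂ), ∃ c : ℂ, y = c • e n := by
    intro n y hy
    rw [hu, Submodule.mem_span_singleton] at hy
    obtain ⟨c, rfl⟩ := hy
    refine ⟨c * ‖u n‖, ?_⟩
    have : (‖u n‖ : ℂ) ≠ 0 := by simpa using hune n
    simp only [e]
    rw [smul_smul, mul_assoc]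
    push_cast
    rw [mul_inv_cancel₀ this, mul_one]
  refine ⟨e, ⟨?_, ?_⟩, fun n => mem_eigenspace_iff.mp (hemem n), fun x hx => ?_⟩
  · intro n
    simp only [e]
    rw [norm_smul, Complex.norm_real, norm_inv, norm_norm,
      inv_mul_cancel₀ (norm_ne_zero_iff.mpr (hune n))]
  · intro m n hmn
    have hne : (μ m : ℂ) ≠ (μ n : ℂ) := fun h => hmn (hanti.injective (by exact_mod_cast h))
    exact hsymm.orthogonalFamily_eigenspaces hne ⟨e m, hemem m⟩ ⟨e n, hemem n⟩
  -- By symmetry `B x` is orthogonal to every eigenspace: to the kernel trivially, to that of `μ n`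
  -- because x ⟂ e n. The spectral theorem then forces B x = 0.
  · have hmem : B x ∈ (⨆ c, eigenspace (B : Module.End ℂ H) c)ᗮ := by
      rw [← Submodule.iInf_orthogonal, Submodule.mem_iInf]
      intro c
      rw [Submodule.mem_orthogonal]
      intro y hy
      have hyB : B y = c • y := mem_eigenspace_iff.mp hy
      have hBy : ⟪y, B x⟫_ℂ = ⟪B y, x⟫_ℂ := (hsymm y x).symm
      rw [hBy]
      by_cases hbot : eigenspace (B : Module.End ℂ H) c = ⊥
      · rw [hbot, Submodule.mem_bot] at hy
        simp [hy]
      have hev : HasEigenvalue (B : Module.End ℂ H) c := hbot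
      have hreal : ((c.re : ℝ) : ℂ) = c := Complex.conj_eq_iff_re.mp
        (hsymm.conj_eigenvalue_eq_self hev)
      have hnn : 0 ≤ c.re := eigenvalue_nonneg_of_nonneg (𝕜 := ℂ) (T := (B : H →ₗ[ℂ] H))
        (μ := c.re) (by rw [show (RCLike.ofReal c.re : ℂ) = c from hreal]; exact hev)
        fun z => hB.re_inner_nonneg_right z
      rcases hnn.eq_or_lt with h0 | h0
      · rw [hyB, ← hreal, ← h0]
        simp
      · obtain ⟨n, hn⟩ := heig h0 (by rw [hreal]; exact hbot)
        rw [← hreal, hn] at hy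
        obtain ⟨d, rfl⟩ := hspan_e n y hy
        rw [hyB, inner_smul_left, inner_smul_left, hx n]
        simp
    rw [ContinuousLinearMap.orthogonalComplement_iSup_eigenspaces_eq_bot hc hsymm,
      Submodule.mem_bot] at hmem
    exact hmem

/-- The closed star subalgebra of the compact operators with a compact adjoint. -/
def compactStarSubalgebra : NonUnitalStarSubalgebra ℂ (H →L[ℂ] H) where
  carrier := {B : H →L[ℂ] H | IsCompactOperator B ∧ IsCompactOperator (star B : H →L[ℂ] H)}
  add_mem' := fun {a b} ha hb => ⟨ha.1.add hb.1, by
    rw [star_add a b]; exact ha.2.add hb.2⟩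
  zero_mem' := ⟨isCompactOperator_zero, by
    rw [star_zero (H →L[ℂ] H)]; exact isCompactOperator_zero⟩
  mul_mem' := fun {a b} ha hb => ⟨ha.1.comp_clm b, by
    rw [star_mul a b]; exact hb.2.comp_clm (star a)⟩
  smul_mem' := fun c a ha => ⟨ha.1.smul c, by
    rw [star_smul c a]; exact ha.2.smul (star c)⟩
  star_mem' := fun {a} ha => ⟨ha.2, by
    rw [star_star a]; exact ha.1⟩

theorem isClosed_compactStarSubalgebra :
    IsClosed ((compactStarSubalgebra : NonUnitalStarSubalgebra ℂ (H →L[ℂ] H)) :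
      Set (H →L[ℂ] H)) := by
  have h : IsClosed {B : H →L[ℂ] H | IsCompactOperator B} := isClosed_setOfPred_isCompactOperator
  exact h.inter (h.preimage continuous_star)

/-- The non-unital functional calculus of T*T stays in every closed star subalgebra containing T*T.
-/
theorem abs_mem_compactStarSubalgebra {T : H →L[ℂ] H} (hT : IsCompactOperator T) :
    CFC.abs T ∈ (compactStarSubalgebra : NonUnitalStarSubalgebra ℂ (H →L[ℂ] H)) := by
  have hcl : IsClosed ((compactStarSubalgebra : NonUnitalStarSubalgebra ℂ (H →L[ℂ] H)) :
      Set (H →L[ℂ] H)) := isClosed_compactStarSubalgebra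
  have hmem : star T * T ∈ (compactStarSubalgebra : NonUnitalStarSubalgebra ℂ (H →L[ℂ] H)) := by
    refine ⟨hT.clm_comp (star T), ?_⟩
    rw [star_mul (star T) T, star_star]
    exact hT.clm_comp (star T)
  rw [CFC.abs, CFC.sqrt_eq_real_sqrt _ (star_mul_self_nonneg T)]
  exact cfcₙ_mem (𝕜 := ℝ) (𝕜' := ℂ) Real.sqrt hmem

theorem isCompactOperator_abs {T : H →L[ℂ] H} (hT : IsCompactOperator T) :
    IsCompactOperator (CFC.abs T : H →L[ℂ] H) := (abs_mem_compactStarSubalgebra hT).1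

theorem isCompactOperator_absPow {T : H →L[ℂ] H} (hT : IsCompactOperator T) {γ : ℝ}
    (hγ : 0 < γ) : IsCompactOperator (absPow T γ) := by
  have hcl : IsClosed ((compactStarSubalgebra : NonUnitalStarSubalgebra ℂ (H →L[ℂ] H)) :
      Set (H →L[ℂ] H)) := isClosed_compactStarSubalgebra
  have h1 : absPow T γ = cfcₙ (fun x : ℝ => x ^ γ) (CFC.abs T) := by
    have := CFC.nnrpow_eq_rpow (a := CFC.abs T) (x := ⟨γ, hγ.le⟩) hγ
    exact this.symm.trans (CFC.nnrpow_eq_cfcₙ_real (CFC.abs T) ⟨γ, hγ.le⟩ (CFC.abs_nonneg T))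
  rw [h1]
  exact (cfcₙ_mem (𝕜 := ℝ) (𝕜' := ℂ) _ (abs_mem_compactStarSubalgebra hT)).1

theorem isPositive_absPow (T : H →L[ℂ] H) (γ : ℝ) : (absPow T γ).IsPositive :=
  (ContinuousLinearMap.nonneg_iff_isPositive _).mp CFC.rpow_nonneg

/-- Clear for polynomials, hence by Stone–Weierstrass for continuous functions; x ≠ 0 puts `s` in
the spectrum, so that evaluation at `s` makes sense. -/
theorem cfc_apply_eq_smul {a : H →L[ℂ] H} (ha : IsSelfAdjoint a) {x : H} {s : ℝ}
    (hx : a x = (s : ℂ) • x) {f : ℝ → ℝ} (hf : ContinuousOn f (spectrum ℝ a)) :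
    cfc f a x = (f s : ℂ) • x := by
  rcases eq_or_ne x 0 with rfl | hx0
  · simp
  have hs : s ∈ spectrum ℝ a := by
    rw [spectrum.mem_iff]
    intro hu
    have h0 : (algebraMap ℝ (H →L[ℂ] H) s - a) x = 0 := by
      rw [sub_apply, hx, Algebra.algebraMap_eq_smul_one]
      simp
    obtain ⟨b, hb⟩ := hu.exists_left_inv
    have : (b * (algebraMap ℝ (H →L[ℂ] H) s - a)) x = 0 := by
      rw [mul_apply_eq_comp, h0, map_zero]
    rw [hb] at this
    exact hx0 this
  have key : ∀ g : C(spectrum ℝ a, ℝ), cfcHom ha g x = (g ⟨s, hs⟩ : ℂ) • x := by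
    intro g
    have hid : cfcHom ha (.restrict (spectrum ℝ a) <| .id ℝ) x = (s : ℂ) • x := by
      rw [cfcHom_id ha, hx]
    induction g using ContinuousMap.induction_on_of_compact with
    | const r =>
      have : cfcHom ha (ContinuousMap.const _ r) = algebraMap ℝ (H →L[ℂ] H) r :=
        AlgHomClass.commutes (cfcHom ha) r
      rw [this, Algebra.algebraMap_eq_smul_one]
      simp
    | id => exact hid
    | star_id => exact hid
    | add f g hf hg => simp [hf, hg, add_smul]
    | mul f g hf hg =>
      rw [map_mul, mul_apply_eq_comp, hg, map_smul, hf, smul_smul, ContinuousMap.mul_apply,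
        Complex.ofReal_mul, mul_comm]
    | frequently f h =>
      refine h.mem_of_closed (isClosed_eq ?_ ?_)
      · have := cfcHom_continuous (R := ℝ) ha
        fun_prop
      · have : Continuous fun g : C(spectrum ℝ a, ℝ) => g ⟨s, hs⟩ := by fun_prop
        fun_prop
  rw [cfc_apply f a ha hf]
  exact key _

theorem IsDiagonal.absPow {T : H →L[ℂ] H} {e : ℕ → H} {μ : ℕ → ℝ}
    (h : IsDiagonal (CFC.abs T) e μ) {γ : ℝ} (hγ : 0 < γ) :
    IsDiagonal (absPow T γ) e fun n => μ n ^ γ := by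
  have hsa : IsSelfAdjoint (CFC.abs T) := (CFC.abs_nonneg T).isSelfAdjoint
  have hcont : ContinuousOn (fun x : ℝ => x ^ γ) (spectrum ℝ (CFC.abs T)) :=
    (Real.continuous_rpow_const hγ.le).continuousOn
  have heq : _root_.absPow T γ = cfc (fun x : ℝ => x ^ γ) (CFC.abs T) :=
    CFC.rpow_eq_cfc_real (CFC.abs_nonneg T)
  refine ⟨h.orthonormal, fun n => ?_, fun x hx => ?_⟩
  · rw [heq, cfc_apply_eq_smul hsa (h.apply n) hcont]
  -- The complement of the `e n` is treated as eigenspace for 0, and 0 ^ γ = 0.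
  · have h0 : CFC.abs T x = ((0 : ℝ) : ℂ) • x := by simp [h.apply_eq_zero x hx]
    rw [heq, cfc_apply_eq_smul hsa h0 hcont, Real.zero_rpow hγ.ne']
    simp

end Diagonalisation

/-! ### The profile f, its mean slopes, and suitable dyadic windows. -/

section Profile

variable {α β : ℝ} {a : ℕ → ℝ}

theorem breakPoint_zero (ha0 : a 0 = 0) : breakPoint a 0 = 0 := by
  simp [breakPoint, ha0]

theorem breakPoint_succ (a : ℕ → ℝ) (n : ℕ) :
    breakPoint a (n + 1) = breakPoint a n + a (n + 1) :=
  Finset.sum_range_succ _ _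

theorem nonneg_of_monotone_zero (ha : Monotone a) (ha0 : a 0 = 0) (n : ℕ) : 0 ≤ a n :=
  ha0 ▸ ha (Nat.zero_le n)

theorem breakPoint_monotone (ha : Monotone a) (ha0 : a 0 = 0) : Monotone (breakPoint a) :=
  monotone_nat_of_le_succ fun n => by
    rw [breakPoint_succ]
    linarith [nonneg_of_monotone_zero ha ha0 (n + 1)]

theorem nat_mul_le_breakPoint (ha : Monotone a) (ha0 : a 0 = 0) (n : ℕ) :
    n * a 1 ≤ breakPoint a n := by
  induction n with
  | zero => simp [breakPoint_zero ha0]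
  | succ n ih =>
    rw [breakPoint_succ]
    push_cast
    linarith [ha (Nat.le_add_left 1 n)]

theorem tendsto_breakPoint (ha : Monotone a) (ha0 : a 0 = 0) (ha1 : 0 < a 1) :
    Tendsto (breakPoint a) atTop atTop :=
  tendsto_atTop_mono (nat_mul_le_breakPoint ha ha0)
    (tendsto_natCast_atTop_atTop.atTop_mul_const ha1)

theorem exists_mem_Ico_breakPoint (ha : Monotone a) (ha0 : a 0 = 0) (ha1 : 0 < a 1) {t : ℝ}
    (ht : 0 ≤ t) : ∃ n, t ∈ Set.Ico (breakPoint a n) (breakPoint a (n + 1)) := by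
  classical
  have hex : ∃ n, t < breakPoint a n := ((tendsto_breakPoint ha ha0 ha1).eventually_gt_atTop t).exists
  have h0 : Nat.find hex ≠ 0 := fun h => by
    have := Nat.find_spec hex
    rw [h, breakPoint_zero ha0] at this
    linarith
  obtain ⟨n, hn⟩ := Nat.exists_eq_succ_of_ne_zero h0
  refine ⟨n, not_lt.mp (Nat.find_min hex (by omega)), ?_⟩
  have := Nat.find_spec hex
  rwa [hn] at this

theorem slopeFun_of_even {n : ℕ} (hn : Even n) {t : ℝ}
    (ht : t ∈ Set.Ico (breakPoint a n) (breakPoint a (n + 1))) : slopeFun α β a t = α :=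
  if_pos ⟨n, hn, ht⟩

theorem slopeFun_of_odd (ha : Monotone a) (ha0 : a 0 = 0) {n : ℕ} (hn : Odd n) {t : ℝ}
    (ht : t ∈ Set.Ico (breakPoint a n) (breakPoint a (n + 1))) : slopeFun α β a t = β := by
  refine if_neg ?_
  rintro ⟨m, hm, hmt⟩
  have hb := breakPoint_monotone ha ha0
  have h1 : m < n + 1 := hb.reflect_lt (hmt.1.trans_lt ht.2)
  have h2 : n < m + 1 := hb.reflect_lt (ht.1.trans_lt hmt.2)
  have : m = n := by omega
  exact (Nat.not_even_iff_odd.mpr hn) (this ▸ hm)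

theorem slopeFun_mem_Icc (hβα : β ≤ α) (t : ℝ) : slopeFun α β a t ∈ Set.Icc β α := by
  unfold slopeFun
  split_ifs
  · exact ⟨hβα, le_rfl⟩
  · exact ⟨le_rfl, hβα⟩

theorem measurable_slopeFun : Measurable (slopeFun α β a) := by
  refine Measurable.ite ?_ measurable_const measurable_const
  have : {t : ℝ | ∃ n : ℕ, Even n ∧ t ∈ Set.Ico (breakPoint a n) (breakPoint a (n + 1))}
      = ⋃ n : ℕ, ⋃ _ : Even n, Set.Ico (breakPoint a n) (breakPoint a (n + 1)) := by
    ext t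
    simp only [Set.mem_ofPred_eq, Set.mem_iUnion, exists_prop]
  rw [this]
  exact MeasurableSet.iUnion fun n => MeasurableSet.iUnion fun _ => measurableSet_Ico

theorem intervalIntegrable_slopeFun (hβα : β ≤ α) (s t : ℝ) :
    IntervalIntegrable (slopeFun α β a) volume s t := by
  have hc : IntervalIntegrable (fun _ : ℝ => max |β| |α|) volume s t :=
    intervalIntegrable_const
  refine hc.mono_fun measurable_slopeFun.aestronglyMeasurable (ae_of_all _ fun x => ?_)
  obtain ⟨h1, h2⟩ := slopeFun_mem_Icc (a := a) hβα x
  simp only [Real.norm_eq_abs]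
  exact (abs_le_max_abs_abs h1 h2).trans (le_abs_self _)

theorem profileFun_sub (hβα : β ≤ α) (s t : ℝ) :
    profileFun α β a t - profileFun α β a s = ∫ x in s..t, slopeFun α β a x :=
  intervalIntegral.integral_interval_sub_left (intervalIntegrable_slopeFun hβα _ _)
    (intervalIntegrable_slopeFun hβα _ _)

theorem profileFun_zero : profileFun α β a 0 = 0 := by
  simp [profileFun]

theorem profileFun_sub_le (hβα : β ≤ α) {s t : ℝ} (h : s ≤ t) :
    profileFun α β a t - profileFun α β a s ≤ α * (t - s) := by
  rw [profileFun_sub hβα]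
  have := intervalIntegral.integral_mono_on h (intervalIntegrable_slopeFun (a := a) hβα s t)
    (intervalIntegrable_const (c := α)) fun x _ => (slopeFun_mem_Icc hβα x).2
  rw [intervalIntegral.integral_const, smul_eq_mul] at this
  linarith

theorem le_profileFun_sub (hβα : β ≤ α) {s t : ℝ} (h : s ≤ t) :
    β * (t - s) ≤ profileFun α β a t - profileFun α β a s := by
  rw [profileFun_sub hβα]
  have := intervalIntegral.integral_mono_on h (intervalIntegrable_const (c := β))
    (intervalIntegrable_slopeFun (a := a) hβα s t) fun x _ => (slopeFun_mem_Icc hβα x).1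
  rw [intervalIntegral.integral_const, smul_eq_mul] at this
  linarith

theorem profileFun_sub_of_slope_eq (hβα : β ≤ α) {c l r s t : ℝ} (hls : l ≤ s) (h : s ≤ t)
    (htr : t ≤ r) (hc : ∀ x ∈ Set.Ico l r, slopeFun α β a x = c) :
    profileFun α β a t - profileFun α β a s = c * (t - s) := by
  rw [profileFun_sub hβα, intervalIntegral.integral_congr_ae (g := fun _ => c)]
  · rw [intervalIntegral.integral_const, smul_eq_mul, mul_comm]
  · have hne : ∀ᵐ x : ℝ, x ≠ t := by simp [ae_iff]
    filter_upwards [hne] with x hx hmem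
    rw [Set.uIoc_of_le h] at hmem
    exact hc x ⟨hls.trans hmem.1.le, (lt_of_le_of_ne hmem.2 hx).trans_le htr⟩

theorem profileFun_sub_of_even (hβα : β ≤ α) {n : ℕ} (hn : Even n) {s t : ℝ}
    (hs : breakPoint a n ≤ s) (h : s ≤ t) (ht : t ≤ breakPoint a (n + 1)) :
    profileFun α β a t - profileFun α β a s = α * (t - s) :=
  profileFun_sub_of_slope_eq hβα hs h ht fun _ hx => slopeFun_of_even hn hx

theorem profileFun_sub_of_odd (hβα : β ≤ α) (ha : Monotone a) (ha0 : a 0 = 0) {n : ℕ}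
    (hn : Odd n) {s t : ℝ} (hs : breakPoint a n ≤ s) (h : s ≤ t)
    (ht : t ≤ breakPoint a (n + 1)) :
    profileFun α β a t - profileFun α β a s = β * (t - s) :=
  profileFun_sub_of_slope_eq hβα hs h ht fun _ hx => slopeFun_of_odd ha ha0 hn hx

theorem profileFun_monotone (hβ : 0 < β) (hβα : β ≤ α) : Monotone (profileFun α β a) :=
  fun s t h => by
    have h1 := le_profileFun_sub (a := a) hβα h
    have h2 : 0 ≤ β * (t - s) := mul_nonneg hβ.le (by linarith)
    linarith

theorem profileFun_strictMono (hβ : 0 < β) (hβα : β ≤ α) : StrictMono (profileFun α β a) :=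
  fun s t h => by
    have h1 := le_profileFun_sub (a := a) hβα h.le
    have h2 : 0 < β * (t - s) := mul_pos hβ (by linarith)
    linarith

/-- For a bounded sequence of lengths the profile stays close to the line of the mean slope. -/
theorem abs_profileFun_sub_le (hβ : 0 < β) (hβα : β ≤ α) (ha : Monotone a) (ha0 : a 0 = 0)
    (ha1 : 0 < a 1) {M : ℝ} (hM : ∀ n, a n ≤ M) {t : ℝ} (ht : 0 ≤ t) :
    |profileFun α β a t - (α + β) / 2 * t| ≤ 2 * α * M := by
  have hM0 : 0 ≤ M := ha0 ▸ hM 0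
  -- With δ = (α - β)/2, the deviation from the line gains δ a (2m+1) and then loses δ a (2m+2). As
  -- `a` is monotone, this alternating sum stays between -δ a (2m) and 0 at the even break points.
  have hbreak : ∀ m : ℕ,
      profileFun α β a (breakPoint a (2 * m)) - (α + β) / 2 * breakPoint a (2 * m) ≤ 0 ∧
      -((α - β) / 2 * a (2 * m)) ≤
        profileFun α β a (breakPoint a (2 * m)) - (α + β) / 2 * breakPoint a (2 * m) := by
    intro m
    induction m with
    | zero => simp [breakPoint_zero ha0, profileFun_zero, ha0]
    | succ m ih =>
      have hb := breakPoint_monotone ha ha0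
      have h1 := profileFun_sub_of_even (a := a) hβα (even_two_mul m) le_rfl
        (hb (Nat.le_succ (2 * m))) le_rfl
      have h2 := profileFun_sub_of_odd hβα ha ha0 (odd_two_mul_add_one m) le_rfl
        (hb (Nat.le_succ (2 * m + 1))) le_rfl
      have e1 := breakPoint_succ a (2 * m)
      have e2 := breakPoint_succ a (2 * m + 1)
      have m1 := ha (Nat.le_succ (2 * m))
      have m2 := ha (Nat.le_succ (2 * m + 1))
      simp only [Nat.succ_eq_add_one] at h1 h2 m1 m2
      have e3 : 2 * (m + 1) = 2 * m + 1 + 1 := by ring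
      rw [e3]
      rw [e1] at h1 h2 e2
      rw [e2] at h2 ⊢
      have hδ : 0 ≤ (α - β) / 2 := by linarith
      constructor <;> nlinarith [mul_le_mul_of_nonneg_left m1 hδ, mul_le_mul_of_nonneg_left m2 hδ]
  obtain ⟨n, hn1, hn2⟩ := exists_mem_Ico_breakPoint ha ha0 ha1 ht
  obtain ⟨m, hm1, hm2⟩ : ∃ m, breakPoint a (2 * m) ≤ t ∧ t ≤ breakPoint a (2 * m) + 2 * M := by
    have hb := breakPoint_monotone ha ha0
    refine ⟨n / 2, (hb (by omega)).trans hn1, hn2.le.trans ?_⟩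
    have h3 : n + 1 ≤ 2 * (n / 2) + 1 + 1 := by omega
    refine (hb h3).trans ?_
    rw [breakPoint_succ, breakPoint_succ]
    linarith [hM (2 * (n / 2) + 1), hM (2 * (n / 2) + 1 + 1)]
  obtain ⟨h1, h2⟩ := hbreak m
  have h3 := profileFun_sub_le (a := a) hβα hm1
  have h4 := le_profileFun_sub (a := a) hβα hm1
  have hδ : 0 ≤ (α - β) / 2 := by linarith
  have h5 := mul_le_mul_of_nonneg_left (hM (2 * m)) hδ
  have h6 : (α - β) / 2 * (t - breakPoint a (2 * m)) ≤ (α - β) / 2 * (2 * M) :=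
    mul_le_mul_of_nonneg_left (by linarith) hδ
  have h7 : 0 ≤ β * M := by positivity
  rw [abs_le]
  constructor <;> nlinarith

/-- The function `f` grows asymptotically with extremal mean slopes `A` and `B`: all increments
over an interval of length `h` lie between `B * h` and `A * h` up to a constant, and both bounds
are attained, up to a constant, on intervals arbitrarily far to the right. -/
structure HasExtremalSlopes (f : ℝ → ℝ) (A B C : ℝ) : Prop where
  sub_le : ∀ t h, 0 ≤ t → 0 ≤ h → f (t + h) - f t ≤ A * h + C
  le_sub : ∀ t h, 0 ≤ t → 0 ≤ h → B * h - C ≤ f (t + h) - f t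
  frequently_le_sub : ∀ h, 0 < h → ∃ᶠ t in atTop, A * h - C ≤ f (t + h) - f t
  frequently_sub_le : ∀ h, 0 < h → ∃ᶠ t in atTop, f (t + h) - f t ≤ B * h + C

theorem HasExtremalSlopes.of_abs_sub_le {f : ℝ → ℝ} {c C : ℝ}
    (h : ∀ t, 0 ≤ t → |f t - c * t| ≤ C) : HasExtremalSlopes f c c (2 * C) := by
  have key : ∀ t s, 0 ≤ t → 0 ≤ s →
      f (t + s) - f t ≤ c * s + 2 * C ∧ c * s - 2 * C ≤ f (t + s) - f t := by
    intro t s ht hs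
    have h1 := abs_le.mp (h t ht)
    have h2 := abs_le.mp (h (t + s) (by positivity))
    constructor <;> linarith [h1.1, h1.2, h2.1, h2.2]
  refine ⟨fun t s ht hs => (key t s ht hs).1, fun t s ht hs => (key t s ht hs).2,
    fun s hs => Eventually.frequently ?_, fun s hs => Eventually.frequently ?_⟩
  · filter_upwards [eventually_ge_atTop 0] with t ht using (key t s ht hs.le).2
  · filter_upwards [eventually_ge_atTop 0] with t ht using (key t s ht hs.le).1

/-- The intervals of constant slope become arbitrarily long, so every length h eventually fits into
one of each kind. -/
theorem hasExtremalSlopes_profileFun (hβα : β ≤ α) (ha : Monotone a) (ha0 : a 0 = 0)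
    (ha1 : 0 < a 1) (hunb : Tendsto a atTop atTop) :
    HasExtremalSlopes (profileFun α β a) α β 0 := by
  have htwo : Tendsto (fun m : ℕ => 2 * m) atTop atTop :=
    tendsto_id.const_mul_atTop' (by norm_num)
  have htwo1 : Tendsto (fun m : ℕ => 2 * m + 1) atTop atTop :=
    tendsto_atTop_mono (fun m => Nat.le_succ _) htwo
  have hb := tendsto_breakPoint ha ha0 ha1
  refine ⟨fun t h _ hh => ?_, fun t h _ hh => ?_, fun h hh => ?_, fun h hh => ?_⟩
  · have := profileFun_sub_le (a := a) hβα (le_add_of_nonneg_right hh : t ≤ t + h)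
    rw [add_sub_cancel_left] at this
    linarith
  · have := le_profileFun_sub (a := a) hβα (le_add_of_nonneg_right hh : t ≤ t + h)
    rw [add_sub_cancel_left] at this
    linarith
  · refine (hb.comp htwo).frequently (Eventually.frequently ?_)
    filter_upwards [(hunb.comp htwo1).eventually_ge_atTop h] with m hm
    have := profileFun_sub_of_even (a := a) hβα (even_two_mul m) le_rfl
      (le_add_of_nonneg_right hh.le) (by rw [breakPoint_succ]; simpa using hm)
    simp only [Function.comp]
    linarith
  · refine (hb.comp htwo1).frequently (Eventually.frequently ?_)
    filter_upwards [(hunb.comp htwo1).eventually_ge_atTop h] with m hm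
    have := profileFun_sub_of_odd hβα ha ha0 (odd_two_mul_add_one m) le_rfl
      (le_add_of_nonneg_right hh.le) (by
        rw [breakPoint_succ a (2 * m + 1)]
        have := ha (Nat.le_succ (2 * m + 1))
        simpa using hm.trans this)
    simp only [Function.comp]
    linarith

theorem exp_mul_exp_eq (f : ℝ → ℝ) (γ : ℝ) (j : ℕ) :
    2 ^ j * Real.exp (-(γ * f (j * Real.log 2)))
      = Real.exp (j * Real.log 2 - γ * f (j * Real.log 2)) := by
  rw [sub_eq_add_neg, Real.exp_add, ← Real.log_pow, Real.exp_log (by positivity)]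

/-- Dyadic windows around the points where the slope changes from `β` to `α`. -/
theorem exists_window_of_unbounded (hβα : β ≤ α) (ha : Monotone a)
    (ha0 : a 0 = 0) (ha1 : 0 < a 1) (hunb : Tendsto a atTop atTop) {γ : ℝ}
    (h1 : γ * β ≤ 1) (h2 : 1 ≤ γ * α) (k : ℕ) :
    ∃ p q : ℕ, p < q ∧ k ≤ p ∧
      k * Real.exp (p * Real.log 2 - γ * profileFun α β a (p * Real.log 2)) ≤
        ∑ j ∈ Finset.Ico p q,
          Real.exp (j * Real.log 2 - γ * profileFun α β a (j * Real.log 2)) ∧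
      k * Real.exp (q * Real.log 2 - γ * profileFun α β a (q * Real.log 2)) ≤
        ∑ j ∈ Finset.Ico p q,
          Real.exp (j * Real.log 2 - γ * profileFun α β a (j * Real.log 2)) := by
  set L := Real.log 2
  have hL0 : 0 < L := Real.log_pos (by norm_num)
  have hL1 : L < 1 := Real.log_two_lt_d9.trans (by norm_num)
  have htwo : Tendsto (fun m : ℕ => 2 * m) atTop atTop :=
    tendsto_id.const_mul_atTop' (by norm_num)
  have htwo1 : Tendsto (fun m : ℕ => 2 * m + 1) atTop atTop :=
    tendsto_atTop_mono (fun m => Nat.le_succ _) htwo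
  have hb := tendsto_breakPoint ha ha0 ha1
  -- On each side of the break `b` the slope is constant over a length of at least k + 2: room for k
  -- steps of size log 2 < 1 and for rounding `b` to the dyadic grid. The bound 2k ≤ b ensures k ≤
  -- p.
  obtain ⟨m, hm1, hm2⟩ := (((hunb.comp htwo1).eventually_ge_atTop (k + 2 : ℝ)).and
    ((hb.comp htwo).eventually_ge_atTop (2 * k : ℝ))).exists
  simp only [Function.comp] at hm1 hm2
  have hmono := breakPoint_monotone ha ha0
  set b := breakPoint a (2 * m + 1 + 1)
  have hbk : (2 * k : ℝ) ≤ b := hm2.trans (hmono (by omega))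
  have hleft : breakPoint a (2 * m + 1) + (k + 2) ≤ b := by
    have := breakPoint_succ a (2 * m + 1)
    linarith [ha (Nat.le_succ (2 * m + 1))]
  have hright : b + (k + 2) ≤ breakPoint a (2 * m + 1 + 1 + 1) := by
    have := breakPoint_succ a (2 * m + 1 + 1)
    linarith [ha (show 2 * m + 1 ≤ 2 * m + 1 + 1 + 1 by omega)]
  set s := ⌊b / L⌋₊
  have hb0 : 0 ≤ b := le_trans (by positivity) hbk
  have hs1 : s * L ≤ b := by
    rw [← le_div_iff₀ hL0]
    exact Nat.floor_le (by positivity)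
  have hs2 : b ≤ (s + 1) * L := by
    rw [← div_le_iff₀ hL0]
    exact (Nat.lt_floor_add_one _).le
  have hs3 : 2 * k ≤ s := Nat.le_floor (by
    push_cast
    rw [le_div_iff₀ hL0]
    nlinarith [(Nat.cast_nonneg k : (0 : ℝ) ≤ k)])
  obtain ⟨p, hp⟩ : ∃ p, s = p + k := ⟨s - k, by omega⟩
  have hkL : k * L ≤ (k : ℝ) := mul_le_of_le_one_right (Nat.cast_nonneg k) hL1.le
  have hsp : (s : ℝ) = p + k := by exact_mod_cast hp
  have hpL : breakPoint a (2 * m + 1) ≤ p * L := by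
    rw [hsp] at hs2
    nlinarith
  have hqL : ((s + 1 + k : ℕ) : ℝ) * L ≤ breakPoint a (2 * m + 1 + 1 + 1) := by
    push_cast
    nlinarith
  -- Left of `b`, t - γ f(t) has slope 1 - γβ ≥ 0, so the term at `p` is the least of these k terms.
  have hup : ∀ j ∈ Finset.Ico p s, Real.exp (p * L - γ * profileFun α β a (p * L)) ≤
      Real.exp (j * L - γ * profileFun α β a (j * L)) := by
    intro j hj
    rw [Finset.mem_Ico] at hj
    have hpj : (p * L : ℝ) ≤ j * L := by gcongr; exact hj.1
    have hjs : (j * L : ℝ) ≤ s * L := by gcongr; exact hj.2.le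
    have := profileFun_sub_of_odd hβα ha ha0 (odd_two_mul_add_one m) hpL hpj (hjs.trans hs1)
    rw [Real.exp_le_exp]
    linear_combination mul_nonneg (sub_nonneg.mpr h1) (sub_nonneg.mpr hpj) + γ * this
  -- Right of `b` the slope is 1 - γα ≤ 0, so the term at the upper end bounds these k terms from
  -- below.
  have hdown : ∀ j ∈ Finset.Ico (s + 1) (s + 1 + k),
      Real.exp ((s + 1 + k : ℕ) * L - γ * profileFun α β a ((s + 1 + k : ℕ) * L)) ≤
      Real.exp (j * L - γ * profileFun α β a (j * L)) := by
    intro j hj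
    rw [Finset.mem_Ico] at hj
    have hjq : (j * L : ℝ) ≤ (s + 1 + k : ℕ) * L := by gcongr; exact hj.2.le
    have hsj : ((s + 1 : ℕ) * L : ℝ) ≤ j * L := by gcongr; exact hj.1
    push_cast at hsj
    have := profileFun_sub_of_even (a := a) hβα (n := 2 * m + 1 + 1) (by
      rw [add_assoc]; exact (even_two_mul m).add (by norm_num)) (hs2.trans hsj) hjq hqL
    rw [Real.exp_le_exp]
    linear_combination mul_nonneg (sub_nonneg.mpr h2) (sub_nonneg.mpr hjq) - γ * this
  refine ⟨p, s + 1 + k, by omega, by omega, ?_, ?_⟩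
  · calc _ = ∑ j ∈ Finset.Ico p s, Real.exp (p * L - γ * profileFun α β a (p * L)) := by
          rw [Finset.sum_const, Nat.card_Ico, hp, Nat.add_sub_cancel_left, nsmul_eq_mul]
      _ ≤ _ := Finset.sum_le_sum hup
      _ ≤ _ := Finset.sum_le_sum_of_subset_of_nonneg
          (Finset.Ico_subset_Ico le_rfl (by omega)) fun _ _ _ => (Real.exp_pos _).le
  · calc _ = ∑ j ∈ Finset.Ico (s + 1) (s + 1 + k), Real.exp ((s + 1 + k : ℕ) * L -
          γ * profileFun α β a ((s + 1 + k : ℕ) * L)) := by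
          rw [Finset.sum_const, Nat.card_Ico, Nat.add_sub_cancel_left, nsmul_eq_mul]
      _ ≤ _ := Finset.sum_le_sum hdown
      _ ≤ _ := Finset.sum_le_sum_of_subset_of_nonneg
          (Finset.Ico_subset_Ico (by omega) le_rfl) fun _ _ _ => (Real.exp_pos _).le

/-- As γc = 1, all terms lie between exp(-γC) and exp(γC), so enough terms outweigh k times either
end term. -/
theorem exists_window_of_abs_sub_le {f : ℝ → ℝ} {c C γ : ℝ} (hγ : 0 < γ)
    (h : ∀ t, 0 ≤ t → |f t - c * t| ≤ C) (hγc : γ * c = 1) (k : ℕ) :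
    ∃ p q : ℕ, p < q ∧ k ≤ p ∧
      k * Real.exp (p * Real.log 2 - γ * f (p * Real.log 2)) ≤
        ∑ j ∈ Finset.Ico p q, Real.exp (j * Real.log 2 - γ * f (j * Real.log 2)) ∧
      k * Real.exp (q * Real.log 2 - γ * f (q * Real.log 2)) ≤
        ∑ j ∈ Finset.Ico p q, Real.exp (j * Real.log 2 - γ * f (j * Real.log 2)) := by
  have hL0 : 0 < Real.log 2 := Real.log_pos (by norm_num)
  have key : ∀ j : ℕ, |(j * Real.log 2 - γ * f (j * Real.log 2))| ≤ γ * C := by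
    intro j
    have h1 := h (j * Real.log 2) (by positivity)
    have h2 : (j * Real.log 2 - γ * f (j * Real.log 2))
        = -(γ * (f (j * Real.log 2) - c * (j * Real.log 2))) := by
      rw [mul_sub, ← mul_assoc γ c, hγc]
      ring
    rw [h2, abs_neg, abs_mul, abs_of_pos hγ]
    gcongr
  obtain ⟨r, hr⟩ := exists_nat_ge (k * Real.exp (γ * C) / Real.exp (-(γ * C)))
  have hsum : k * Real.exp (γ * C) ≤ ∑ j ∈ Finset.Ico k (k + (r + 1)),
      Real.exp (j * Real.log 2 - γ * f (j * Real.log 2)) := by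
    rw [div_le_iff₀ (Real.exp_pos _)] at hr
    calc k * Real.exp (γ * C) ≤ r * Real.exp (-(γ * C)) := hr
      _ ≤ (r + 1 : ℕ) * Real.exp (-(γ * C)) := by gcongr; simp
      _ = ∑ j ∈ Finset.Ico k (k + (r + 1)), Real.exp (-(γ * C)) := by simp
      _ ≤ _ := Finset.sum_le_sum fun j _ => Real.exp_le_exp.mpr (abs_le.mp (key j)).1
  refine ⟨k, k + (r + 1), by omega, le_rfl, le_trans ?_ hsum, le_trans ?_ hsum⟩
  · gcongr
    exact (abs_le.mp (key _)).2
  · gcongr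
    exact (abs_le.mp (key _)).2

end Profile

/-! ### From the profile to the operator. -/

section Main

open scoped InnerProductSpace

variable {H : Type*} [NormedAddCommGroup H] [InnerProductSpace ℂ H]

theorem IsDiagonal.exists_subspace_le {A : H →L[ℂ] H} {e : ℕ → H} {l : ℕ → ℝ}
    (hd : IsDiagonal A e l) {n : ℕ} {c : ℝ} (h : ∀ i < n, c ≤ l i) :
    ∃ (V : Submodule ℂ H) (_ : FiniteDimensional ℂ V),
      n ≤ Module.finrank ℂ V ∧ ∀ x ∈ V, c * ‖x‖ ^ 2 ≤ (⟪x, A x⟫_ℂ).re := by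
  have hv : Orthonormal ℂ fun i : Fin n => e i := hd.orthonormal.comp _ Fin.val_injective
  refine ⟨Submodule.span ℂ (Set.range fun i : Fin n => e i),
    FiniteDimensional.span_of_finite ℂ (Set.finite_range _), ?_, fun x hx => ?_⟩
  · rw [finrank_span_eq_card hv.linearIndependent, Fintype.card_fin]
  · obtain ⟨b, rfl⟩ := (Submodule.mem_span_range_iff_exists_fun ℂ).mp hx
    have h1 : ‖∑ i, b i • e i‖ ^ 2 = ∑ i, ‖b i‖ ^ 2 := by
      have h2 := hv.inner_sum b b Finset.univ
      rw [← inner_self_eq_norm_sq (𝕜 := ℂ), h2, map_sum]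
      refine Finset.sum_congr rfl fun i _ => ?_
      rw [Complex.conj_mul', ← Complex.ofReal_pow]
      exact Complex.ofReal_re _
    have h3 : (⟪∑ i, b i • e i, A (∑ i, b i • e i)⟫_ℂ).re = ∑ i : Fin n, l i * ‖b i‖ ^ 2 := by
      have h4 : A (∑ i, b i • e i) = ∑ i : Fin n, (b i * l i) • e i := by
        rw [map_sum]
        refine Finset.sum_congr rfl fun i _ => ?_
        rw [map_smul, hd.apply, smul_smul]
      rw [h4, hv.inner_sum b (fun i => b i * l i) Finset.univ, Complex.re_sum]
      refine Finset.sum_congr rfl fun i _ => ?_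
      rw [← mul_assoc, Complex.conj_mul', ← Complex.ofReal_pow, ← Complex.ofReal_mul,
        Complex.ofReal_re, mul_comm]
    rw [h1, h3, Finset.mul_sum]
    refine Finset.sum_le_sum fun i _ => ?_
    gcongr
    exact h i i.2

variable [CompleteSpace H]

theorem IsDiagonal.dyadicallyDominated {A : H →L[ℂ] H} {e : ℕ → H} {l w : ℕ → ℝ}
    (hd : IsDiagonal A e l) (hw : ∀ j, 0 ≤ w j) (h : ∀ j i, 2 ^ j ≤ i → l i ≤ w j) :
    DyadicallyDominated w A := by
  refine ⟨1, zero_le_one, fun j => ?_⟩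
  refine ⟨Submodule.span ℂ (Set.range fun i : Fin (2 ^ j) => e i),
    FiniteDimensional.span_of_finite ℂ (Set.finite_range _), ?_, fun x hx => ?_⟩
  · exact (finrank_range_le_card _).trans (by simp)
  · have h1 : HasSum (fun n => w j * ‖⟪e n, x⟫_ℂ‖ ^ 2) (w j * ∑' n, ‖⟪e n, x⟫_ℂ‖ ^ 2) :=
      (hd.orthonormal.inner_products_summable x).hasSum.mul_left (w j)
    have h2 := hd.orthonormal.tsum_inner_products_le x
    rw [one_mul]
    refine (hasSum_le (fun i => ?_) (hd.hasSum_re_inner x) h1).trans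
      (mul_le_mul_of_nonneg_left h2 (hw j))
    rcases lt_or_ge i (2 ^ j) with hi | hi
    · have : ⟪e i, x⟫_ℂ = 0 :=
        Submodule.inner_right_of_mem_orthogonal (Submodule.subset_span (Set.mem_range_self (⟨i, hi⟩ : Fin (2 ^ j)))) hx
      simp [this]
    · gcongr
      exact h j i hi

/-! ### The limits that define c̲ and c̄. -/

section Slopes

variable {T : H →L[ℂ] H} {f : ℝ → ℝ} {A B C M : ℝ}

theorem tendsto_ofReal_add_div (A D : ℝ) :
    Tendsto (fun h : ℝ => ENNReal.ofReal (A + D / h)) atTop (𝓝 (ENNReal.ofReal A)) := by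
  refine ENNReal.tendsto_ofReal ?_
  simpa using (tendsto_const_nhds (x := D)).div_atTop tendsto_id |>.const_add A

theorem logSlope_le_ofReal {h t D : ℝ} (hh : 0 < h)
    (hD : logSingularValueFun T (t + h) - logSingularValueFun T t ≤ A * h + D) :
    logSlope T h t ≤ ENNReal.ofReal (A + D / h) := by
  refine ENNReal.ofReal_le_ofReal ?_
  rw [div_le_iff₀ hh, add_mul, div_mul_cancel₀ _ hh.ne']
  exact hD

theorem ofReal_le_logSlope {h t D : ℝ} (hh : 0 < h)
    (hD : A * h + D ≤ logSingularValueFun T (t + h) - logSingularValueFun T t) :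
    ENNReal.ofReal (A + D / h) ≤ logSlope T h t := by
  refine ENNReal.ofReal_le_ofReal ?_
  rw [le_div_iff₀ hh, add_mul, div_mul_cancel₀ _ hh.ne']
  exact hD

/-- The bounded errors `C` and `M` cost at most (C + 2M)/h in the quotient, which vanishes as h → ∞.
-/
theorem HasExtremalSlopes.tendsto_upperSlope (hf : HasExtremalSlopes f A B C)
    (hM : ∀ t, 0 ≤ t → |logSingularValueFun T t - f t| ≤ M) :
    Tendsto (upperSlope T) atTop (𝓝 (ENNReal.ofReal A)) := by
  refine tendsto_of_tendsto_of_tendsto_of_le_of_le' (tendsto_ofReal_add_div A (-(C + 2 * M)))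
    (tendsto_ofReal_add_div A (C + 2 * M)) ?_ ?_
  · filter_upwards [eventually_gt_atTop 0] with h hh
    refine le_limsup_of_frequently_le ?_
    refine ((hf.frequently_le_sub h hh).and_eventually (eventually_ge_atTop 0)).mono ?_
    rintro t ⟨h1, ht⟩
    refine ofReal_le_logSlope hh ?_
    have h2 := abs_le.mp (hM t ht)
    have h3 := abs_le.mp (hM (t + h) (by positivity))
    linarith [h2.1, h2.2, h3.1, h3.2]
  · filter_upwards [eventually_gt_atTop 0] with h hh
    refine limsup_le_of_le (h := ?_)
    filter_upwards [eventually_ge_atTop 0] with t ht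
    refine logSlope_le_ofReal hh ?_
    have h1 := hf.sub_le t h ht hh.le
    have h2 := abs_le.mp (hM t ht)
    have h3 := abs_le.mp (hM (t + h) (by positivity))
    linarith [h2.1, h2.2, h3.1, h3.2]

theorem HasExtremalSlopes.tendsto_lowerSlope (hf : HasExtremalSlopes f A B C)
    (hM : ∀ t, 0 ≤ t → |logSingularValueFun T t - f t| ≤ M) :
    Tendsto (lowerSlope T) atTop (𝓝 (ENNReal.ofReal B)) := by
  refine tendsto_of_tendsto_of_tendsto_of_le_of_le' (tendsto_ofReal_add_div B (-(C + 2 * M)))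
    (tendsto_ofReal_add_div B (C + 2 * M)) ?_ ?_
  · filter_upwards [eventually_gt_atTop 0] with h hh
    refine le_liminf_of_le (h := ?_)
    filter_upwards [eventually_ge_atTop 0] with t ht
    refine ofReal_le_logSlope hh ?_
    have h1 := hf.le_sub t h ht hh.le
    have h2 := abs_le.mp (hM t ht)
    have h3 := abs_le.mp (hM (t + h) (by positivity))
    linarith [h2.1, h2.2, h3.1, h3.2]
  · filter_upwards [eventually_gt_atTop 0] with h hh
    refine liminf_le_of_frequently_le ?_
    refine ((hf.frequently_sub_le h hh).and_eventually (eventually_ge_atTop 0)).mono ?_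
    rintro t ⟨h1, ht⟩
    refine logSlope_le_ofReal hh ?_
    have h2 := abs_le.mp (hM t ht)
    have h3 := abs_le.mp (hM (t + h) (by positivity))
    linarith [h2.1, h2.2, h3.1, h3.2]

/-- Passing from e^t to its integer part loses at most a factor 2, so the argument of f moves by at
most log 2 < 1, and f has slopes at most `α`. -/
theorem abs_logSingularValueFun_sub_le {α β : ℝ} {a : ℕ → ℝ} (hβ : 0 < β) (hβα : β ≤ α)
    (hμ : ∀ n : ℕ, 1 ≤ n →
      singularValue T n = Real.exp (-profileFun α β a (Real.log (n : ℝ))))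
    {t : ℝ} (ht : 0 ≤ t) : |logSingularValueFun T t - profileFun α β a t| ≤ α := by
  have h1 : 1 ≤ ⌊Real.exp t⌋₊ := Nat.le_floor (by simpa using ht)
  have h1' : (1 : ℝ) ≤ ⌊Real.exp t⌋₊ := by exact_mod_cast h1
  have h2 : logSingularValueFun T t = profileFun α β a (Real.log ⌊Real.exp t⌋₊) := by
    rw [logSingularValueFun, singularValueFun, hμ _ h1, Real.log_exp, neg_neg]
  have h3 : Real.log ⌊Real.exp t⌋₊ ≤ t := by
    rw [Real.log_le_iff_le_exp (by linarith)]
    exact Nat.floor_le (Real.exp_pos t).le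
  have h4 : t ≤ Real.log ⌊Real.exp t⌋₊ + 1 := by
    have h5 : Real.exp t ≤ 2 * ⌊Real.exp t⌋₊ := by
      linarith [Nat.lt_floor_add_one (Real.exp t)]
    have h6 := Real.log_le_log (Real.exp_pos t) h5
    rw [Real.log_exp, Real.log_mul two_ne_zero (by linarith)] at h6
    linarith [Real.log_two_lt_d9]
  have h7 := profileFun_sub_le (a := a) hβα h3
  have h8 := le_profileFun_sub (a := a) hβα h3
  have hα : 0 < α := hβ.trans_le hβα
  rw [h2, abs_sub_comm, abs_of_nonneg]
  · nlinarith
  · exact le_trans (mul_nonneg hβ.le (by linarith)) h8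

end Slopes

/-! ### Necessity and sufficiency of the slope conditions. -/

section Traceability

variable {A : H →L[ℂ] H} {e : ℕ → H} {f : ℝ → ℝ} {a b C γ : ℝ}

theorem HasExtremalSlopes.one_le_mul (hf : HasExtremalSlopes f a b C) (hmono : Monotone f)
    (hA : A.IsPositive) (hγ : 0 < γ)
    (hd : IsDiagonal A e fun i => Real.exp (-(γ * f (Real.log (i + 1)))))
    {τ : TracialWeight H} (h0 : τ.toFun A ≠ 0) (htop : τ.toFun A ≠ ∞) : 1 ≤ γ * a := by
  by_contra! hlt
  -- This size of log k makes γ(a log k + C) < log k, which is ck > 1 for the `c` below.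
  obtain ⟨k, hk, hk1⟩ := ((Real.tendsto_log_atTop.comp
    tendsto_natCast_atTop_atTop).eventually_gt_atTop (γ * C / (1 - γ * a)) |>.and
      (eventually_ge_atTop 1)).exists
  simp only [Function.comp] at hk
  rw [div_lt_iff₀ (by linarith)] at hk
  have hk0 : (0 : ℝ) < k := by exact_mod_cast hk1
  refine (τ.eq_zero_or_top_of_slow_decay hA hd (k := k)
    (c := Real.toNNReal (Real.exp (-(γ * (a * Real.log k + C))))) ?_ ?_).elim h0 htop
  · rw [← NNReal.coe_lt_coe]
    push_cast
    rw [Real.coe_toNNReal _ (Real.exp_pos _).le]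
    nth_rw 2 [← Real.exp_log hk0]
    rw [← Real.exp_add, Real.one_lt_exp_iff]
    linarith
  · intro i j hj
    rw [Real.coe_toNNReal _ (Real.exp_pos _).le, ← Real.exp_add, Real.exp_le_exp]
    have hi : (0 : ℝ) < i + 1 := by positivity
    have h1 := hf.sub_le (Real.log (i + 1)) (Real.log k) (Real.log_nonneg (by simp))
      (Real.log_nonneg (by exact_mod_cast hk1))
    rw [← Real.log_mul hi.ne' hk0.ne'] at h1
    have h2 : f (Real.log ((k * i + j : ℕ) + 1)) ≤ f (Real.log ((i + 1) * k)) := by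
      refine hmono (Real.log_le_log (by positivity) ?_)
      have : k * i + j + 1 ≤ (i + 1) * k := by
        rw [add_mul, one_mul, mul_comm i k]
        omega
      exact_mod_cast this
    nlinarith

theorem HasExtremalSlopes.mul_le_one (hf : HasExtremalSlopes f a b C) (hmono : Monotone f)
    (hA : A.IsPositive) (hγ : 0 < γ)
    (hd : IsDiagonal A e fun i => Real.exp (-(γ * f (Real.log (i + 1)))))
    {τ : TracialWeight H} (hτ : τ.IsSingular) (h0 : τ.toFun A ≠ 0) (htop : τ.toFun A ≠ ∞) :
    γ * b ≤ 1 := by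
  by_contra! hlt
  -- Here log k < γ(b log k - C), which is ck < 1 for the `c` below.
  obtain ⟨k, hk, hk1⟩ := ((Real.tendsto_log_atTop.comp
    tendsto_natCast_atTop_atTop).eventually_gt_atTop (γ * C / (γ * b - 1)) |>.and
      (eventually_ge_atTop 1)).exists
  simp only [Function.comp] at hk
  rw [div_lt_iff₀ (by linarith)] at hk
  have hk0 : (0 : ℝ) < k := by exact_mod_cast hk1
  -- The shift k - 1 compensates for the index i carrying the argument log(i + 1): ki + j + (k - 1)
  -- + 1 ≥ k(i + 1).
  refine (TracialWeight.eq_zero_or_top_of_fast_decay hτ hA (fun i => (Real.exp_pos _).le) hd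
    (k := k) (N := k - 1)
    (c := Real.toNNReal (Real.exp (-(γ * (b * Real.log k - C))))) hk1 ?_ ?_).elim h0 htop
  · rw [← NNReal.coe_lt_coe]
    push_cast
    rw [Real.coe_toNNReal _ (Real.exp_pos _).le]
    nth_rw 2 [← Real.exp_log hk0]
    rw [← Real.exp_add, Real.exp_lt_one_iff]
    linarith
  · intro i j hj
    rw [Real.coe_toNNReal _ (Real.exp_pos _).le, ← Real.exp_add, Real.exp_le_exp]
    have hi : (0 : ℝ) < i + 1 := by positivity
    have h1 := hf.le_sub (Real.log (i + 1)) (Real.log k) (Real.log_nonneg (by simp))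
      (Real.log_nonneg (by exact_mod_cast hk1))
    rw [← Real.log_mul hi.ne' hk0.ne'] at h1
    have h2 : f (Real.log ((i + 1) * k)) ≤ f (Real.log ((k * i + j + (k - 1) : ℕ) + 1)) := by
      refine hmono (Real.log_le_log (by positivity) ?_)
      have : (i + 1) * k ≤ k * i + j + (k - 1) + 1 := by
        rw [add_mul, one_mul, mul_comm i k]
        omega
      exact_mod_cast this
    nlinarith

theorem HasExtremalSlopes.exists_singular_trace (hf : HasExtremalSlopes f a b C)
    (hmono : Monotone f) (hγ : 0 < γ)
    (hd : IsDiagonal A e fun i => Real.exp (-(γ * f (Real.log (i + 1)))))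
    (hwin : ∀ k : ℕ, ∃ p q : ℕ, p < q ∧ k ≤ p ∧
      k * Real.exp (p * Real.log 2 - γ * f (p * Real.log 2)) ≤
        ∑ j ∈ Finset.Ico p q, Real.exp (j * Real.log 2 - γ * f (j * Real.log 2)) ∧
      k * Real.exp (q * Real.log 2 - γ * f (q * Real.log 2)) ≤
        ∑ j ∈ Finset.Ico p q, Real.exp (j * Real.log 2 - γ * f (j * Real.log 2))) :
    ∃ τ : TracialWeight H, τ.IsSingular ∧ τ.toFun A ≠ 0 ∧ τ.toFun A ≠ ∞ := by
  choose p q hpq hkp hp hq using hwin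
  simp only [← exp_mul_exp_eq] at hp hq
  -- `K` is the doubling constant: f grows by at most a log 2 + C over a step of length log 2.
  refine _root_.exists_singular_trace (w := fun j => Real.exp (-(γ * f (j * Real.log 2))))
    (K := Real.exp (γ * (a * Real.log 2 + C))) (fun j => Real.exp_pos _) (fun j => ?_) hpq hkp
    hp hq (hd.dyadicallyDominated (fun j => (Real.exp_pos _).le) fun j i hi => ?_)
    fun j => hd.exists_subspace_le fun i hi => ?_
  · rw [← Real.exp_add, Real.exp_le_exp]
    have h1 := hf.sub_le (j * Real.log 2) (Real.log 2) (by positivity) (by positivity)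
    push_cast
    rw [add_mul, one_mul]
    nlinarith
  · rw [Real.exp_le_exp, ← Real.log_pow]
    have hij : (2 ^ j : ℝ) ≤ i + 1 := by exact_mod_cast hi.trans (Nat.le_succ i)
    have := hmono (Real.log_le_log (by positivity) hij)
    nlinarith
  · rw [Real.exp_le_exp, ← Real.log_pow]
    have hij : (i + 1 : ℝ) ≤ 2 ^ j := by exact_mod_cast hi
    have := hmono (Real.log_le_log (by positivity) hij)
    nlinarith

end Traceability

theorem ofReal_mem_Icc_inv_iff {A B γ : ℝ} (hA : 0 < A) (hB : 0 < B) (hγ : 0 < γ) :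
    ENNReal.ofReal γ ∈ Set.Icc (ENNReal.ofReal A)⁻¹ (ENNReal.ofReal B)⁻¹ ↔
      1 ≤ γ * A ∧ γ * B ≤ 1 := by
  rw [← ENNReal.ofReal_inv_of_pos hA, ← ENNReal.ofReal_inv_of_pos hB, Set.mem_Icc,
    ENNReal.ofReal_le_ofReal_iff hγ.le, ENNReal.ofReal_le_ofReal_iff (by positivity),
    inv_le_iff_one_le_mul₀ hA, le_inv_comm₀ hγ hB, inv_eq_one_div, le_div_iff₀ hγ, mul_comm B γ]

/-- The theorem for a profile whose extremal mean slopes are known. -/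
theorem singularlyTraceable_absPow_iff_of_extremalSlopes {α β : ℝ} {a : ℕ → ℝ} (hβ : 0 < β)
    (hβα : β ≤ α) {T : H →L[ℂ] H} (hT : IsCompactOperator T)
    (hμ : ∀ n : ℕ, 1 ≤ n →
      singularValue T n = Real.exp (-profileFun α β a (Real.log (n : ℝ))))
    {A B C : ℝ} (hA : 0 < A) (hB : 0 < B) (hf : HasExtremalSlopes (profileFun α β a) A B C)
    (hwin : ∀ γ : ℝ, 0 < γ → 1 ≤ γ * A → γ * B ≤ 1 → ∀ k : ℕ, ∃ p q : ℕ, p < q ∧ k ≤ p ∧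
      k * Real.exp (p * Real.log 2 - γ * profileFun α β a (p * Real.log 2)) ≤
        ∑ j ∈ Finset.Ico p q,
          Real.exp (j * Real.log 2 - γ * profileFun α β a (j * Real.log 2)) ∧
      k * Real.exp (q * Real.log 2 - γ * profileFun α β a (q * Real.log 2)) ≤
        ∑ j ∈ Finset.Ico p q,
          Real.exp (j * Real.log 2 - γ * profileFun α β a (j * Real.log 2))) :
    (∃ L : ℝ≥0∞, Tendsto (upperSlope T) atTop (𝓝 L)) ∧
    (∃ L : ℝ≥0∞, Tendsto (lowerSlope T) atTop (𝓝 L)) ∧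
    ∀ γ : ℝ, 0 < γ →
      (SingularlyTraceable (absPow T γ) ↔
        ENNReal.ofReal γ ∈ Set.Icc (lowerC T) (upperC T)) := by
  have hup := hf.tendsto_upperSlope fun t ht => abs_logSingularValueFun_sub_le hβ hβα hμ ht
  have hlow := hf.tendsto_lowerSlope fun t ht => abs_logSingularValueFun_sub_le hβ hβα hμ ht
  refine ⟨⟨_, hup⟩, ⟨_, hlow⟩, fun γ hγ => ?_⟩
  rw [lowerC, upperC, hup.limUnder_eq, hlow.limUnder_eq, ofReal_mem_Icc_inv_iff hA hB hγ]
  have hmono := profileFun_monotone (a := a) hβ hβα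
  -- Since β > 0 the profile increases strictly, so the positive eigenvalues of |T| are simple.
  obtain ⟨e, he⟩ := exists_isDiagonal (isCompactOperator_abs hT)
    ((ContinuousLinearMap.nonneg_iff_isPositive _).mp (CFC.abs_nonneg T))
    (μ := fun n => Real.exp (-profileFun α β a (Real.log (n + 1)))) (fun n => Real.exp_pos _)
    (fun m n hmn => by
      refine Real.exp_lt_exp.mpr (neg_lt_neg (profileFun_strictMono hβ hβα ?_))
      exact Real.log_lt_log (by positivity) (by exact_mod_cast Nat.succ_lt_succ hmn))
    (fun n => by
      have := hμ (n + 1) (Nat.le_add_left 1 n)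
      push_cast at this
      exact this)
  have hd : IsDiagonal (absPow T γ) e
      fun i => Real.exp (-(γ * profileFun α β a (Real.log (i + 1)))) := by
    convert he.absPow hγ using 2 with i
    rw [← Real.exp_mul]
    ring_nf
  have hpos := isPositive_absPow T γ
  have habs : CFC.abs (absPow T γ) = absPow T γ :=
    CFC.abs_of_nonneg _ ((ContinuousLinearMap.nonneg_iff_isPositive _).mpr hpos)
  rw [SingularlyTraceable, habs]
  constructor
  · rintro ⟨-, τ, hτ, h0, htop⟩
    exact ⟨hf.one_le_mul hmono hpos hγ hd h0 htop, hf.mul_le_one hmono hpos hγ hd hτ h0 htop⟩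
  · rintro ⟨h1, h2⟩
    exact ⟨isCompactOperator_absPow hT hγ,
      hf.exists_singular_trace hmono hγ hd (hwin γ hγ h1 h2)⟩

end Main

theorem theorem3p1 {H : Type*} [NormedAddCommGroup H] [InnerProductSpace ℂ H] [CompleteSpace H]
    (α β : ℝ) (hβ : 0 < β) (hβα : β ≤ α)
    (a : ℕ → ℝ) (ha : Monotone a) (ha0 : a 0 = 0) (ha1 : 0 < a 1)
    (T : H →L[ℂ] H) (hT : IsCompactOperator T)
    (hμ : ∀ n : ℕ, 1 ≤ n →
      singularValue T n = Real.exp (-profileFun α β a (Real.log (n : ℝ)))) :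
    (∃ L : ℝ≥0∞, Tendsto (upperSlope T) atTop (𝓝 L)) ∧
    (∃ L : ℝ≥0∞, Tendsto (lowerSlope T) atTop (𝓝 L)) ∧
    ∀ γ : ℝ, 0 < γ →
      (SingularlyTraceable (absPow T γ) ↔
        ENNReal.ofReal γ ∈ Set.Icc (lowerC T) (upperC T)) := by
  have hα : 0 < α := hβ.trans_le hβα
  -- The extremal mean slopes are α and β if `a` is unbounded, and both equal (α + β)/2 if `a`
  -- converges.
  rcases tendsto_atTop_of_monotone ha with hunb | ⟨M, hM⟩
  · exact singularlyTraceable_absPow_iff_of_extremalSlopes hβ hβα hT hμ hα hβ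
      (hasExtremalSlopes_profileFun hβα ha ha0 ha1 hunb) fun γ _ h1 h2 =>
        exists_window_of_unbounded hβα ha ha0 ha1 hunb h2 h1
  · have hline : ∀ t, 0 ≤ t → |profileFun α β a t - (α + β) / 2 * t| ≤ 2 * α * M := fun t ht =>
      abs_profileFun_sub_le hβ hβα ha ha0 ha1 (ha.ge_of_tendsto hM) ht
    exact singularlyTraceable_absPow_iff_of_extremalSlopes hβ hβα hT hμ (by positivity)
      -- The admissible interval is now a single point: `h1` and `h2` together give γ(α + β)/2 = 1.
      (by positivity) (HasExtremalSlopes.of_abs_sub_le hline) fun γ hγ h1 h2 =>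
        exists_window_of_abs_sub_le hγ hline (le_antisymm h2 h1)
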